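/- Let $\mathbb K$ be a field of characteristic $p>2$. A Lie superalgebra over $\mathbb K$ is a $\mathbb Z/2$-graded space $\mathfrak a=\mathfrak a_{\bar 0}\oplus\mathfrak a_{\bar 1}$ with an even bilinear super-skew-symmetric bracket satisfying the super Jacobi identity and $[a,[a,a]]=0$ for all $a\in\mathfrak a_{\bar 1}$; the parity of a homogeneous $a$ is $p(a)$, and $\mathrm{ad}_a=[a,\cdot]$. A $p|2p$-structure on $\mathfrak a$ is a map $a\mapsto a^{[p]}$ on $\mathfrak a_{\bar 0}$ with $[a^{[p]},b]=(\mathrm{ad}_a)^p(b)$ for all $a\in\mathfrak a_{\bar 0}$, $b\in\mathfrak a$, with $(\alpha a)^{[p]}=\alpha^pa^{[p]}$ for all $\alpha\in\mathbb K$, and with $(a+b)^{[p]}=a^{[p]}+b^{[p]}+\sum_{i=1}^{p-1}s_i(a,b)$ for $a,b\in\mathfrak a_{\bar 0}$, where $(\mathrm{ad}_{\lambda a+b})^{p-1}(a)=\sum_{i=1}^{p-1}i\,s_i(a,b)\lambda^{i-1}$ (on odd elements one then puts $a^{[2p]}=(\tfrac12[a,a])^{[p]}$). A Lie superalgebra with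 a $p|2p$-structure is called restricted. A NIS is a non-degenerate invariant bilinear form $\mathscr B$, homogeneous of some parity, with $\mathscr B(b,a)=(-1)^{p(a)p(b)}\mathscr B(a,b)$; invariance means $\mathscr B([a,b],c)=\mathscr B(a,[b,c])$. Let $\mathfrak a$ be a restricted Lie superalgebra over $\mathbb K$ with an odd NIS $\mathscr B$. Let $\mathscr D$ be a homogeneous derivation of $\mathfrak a$ of parity $p(\mathscr D)$ that is restricted, $\mathscr D(a^{[p]})=(\mathrm{ad}_a)^{p-1}(\mathscr D(a))$ for all $a\in\mathfrak a_{\bar 0}$, and such that $\mathscr B$ is $\mathscr D$-invariant, $\mathscr B(\mathscr D(a),b)+(-1)^{p(\mathscr D)p(a)}\mathscr B(a,\mathscr D(b))=0$ for all $a,b$. Put $\mathfrak g=\mathbb Kx\oplus\mathfrak a\oplus\mathbb Kx^*$ with $p(x)=p(\mathscr D)+\bar 1$ and $p(x^*)=p(\mathscr D)$, and let $\mathscr B_{\mathfrak g}$ be the form on $\mathfrak g$ that extends $\mathscr B$ and satisfies $\mathscr B_{\mathfrak g}(x,x^*)=\mathscr B_{\mathfrak g}(x^*,x)=1$, $\mathscr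 B_{\mathfrak g}(x,x)=\mathscr B_{\mathfrak g}(x^*,x^*)=0$, and $x,x^*\perp\mathfrak a$. (i) Let $\mathscr D$ be odd with $\mathscr D^2=\mathrm{ad}_{b_0}$ and $\mathscr D(b_0)=0$ for some $b_0\in\mathfrak a_{\bar 0}$, and let $\lambda_0\in\mathbb K$. Define a super-skew-symmetric bracket on $\mathfrak g$ by $$[x,\mathfrak g]_{\mathfrak g}=0,\quad [a,b]_{\mathfrak g}=[a,b]+\mathscr B(\mathscr D(a),b)x,\quad [x^*,a]_{\mathfrak g}=\mathscr D(a)-2(-1)^{p(a)}\mathscr B(a,b_0)x,\quad [x^*,x^*]_{\mathfrak g}=2b_0+\lambda_0x .$$ Then $\mathfrak g$ is a Lie superalgebra and $\mathscr B_{\mathfrak g}$ is an odd NIS on it. There exist maps $\mathscr P:\mathfrak a_{\bar 0}\to\mathbb K$ such that, for all $a,b\in\mathfrak a_{\bar 0}$ and $\lambda\in\mathbb K$, $$\mathscr P(\lambda a)=\lambda^p\mathscr P(a),\qquad \mathscr P(a+b)-\mathscr P(a)-\mathscr P(b)=\sum_{i=1}^{p-1}\sigma_i(a,b),$$ where $\mathscr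 B\big(\mathscr D(\lambda a+b),(\mathrm{ad}_{\lambda a+b})^{p-2}(a)\big)=\sum_{i=1}^{p-1}i\,\sigma_i(a,b)\lambda^{i-1}$. For every such $\mathscr P$, every $m\in\mathbb K$ and every central $c_0\in\mathfrak a_{\bar 0}$ with $\mathscr D(c_0)=0$, there is a $p|2p$-structure on $\mathfrak g$ with $$a^{[p]_{\mathfrak g}}=a^{[p]}+\mathscr P(a)x\quad(a\in\mathfrak a_{\bar 0}),\qquad x^{[p]_{\mathfrak g}}=mx+c_0 .$$ (ii) Let $\mathscr D$ be even with the $p$-property: $\mathscr D^p=\gamma\mathscr D+\mathrm{ad}_{a_0}$ and $\mathscr D(a_0)=0$ for some $\gamma\in\mathbb K$ and $a_0\in\mathfrak a_{\bar 0}$. If $p=3$, suppose also that $\mathscr B(\mathscr D(a),[a,a])=0$ for all $a\in\mathfrak a_{\bar 1}$. Define a super-skew-symmetric bracket on $\mathfrak g$ by $$[x,\mathfrak g]_{\mathfrak g}=0,\quad [a,b]_{\mathfrak g}=[a,b]+\mathscr B(\mathscr D(a),b)x,\quad [x^*,a]_{\mathfrak g}=\mathscr D(a),\quad [x^*,x^*]_{\mathfrak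 g}=0 .$$ Then $\mathfrak g$ is a Lie superalgebra, $\mathscr B_{\mathfrak g}$ is an odd NIS on it, and there is a $p|2p$-structure on $\mathfrak g$ with $$a^{[p]_{\mathfrak g}}=a^{[p]}\quad(a\in\mathfrak a_{\bar 0}),\qquad (x^*)^{[p]_{\mathfrak g}}=\gamma x^*+a_0 .$$ -/

import Mathlib

/-- The Koszul sign `(-1)^{ij}` as a scalar. -/
def koszul (K : Type*) [Field K] (i j : ZMod 2) : K := (-1) ^ (i.val * j.val)

section Super

variable {K L : Type*} [Field K] [AddCommGroup L] [Module K L]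

/-- `L = A 0 ⊕ A 1` with the bracket `br` is a Lie superalgebra (characteristic different from 2).
The identity `[a,[a,a]] = 0` for odd `a` is part of the definition in characteristic 3 and follows
from the Jacobi identity in the other characteristics. -/
structure IsLieSuperalgebra (A : ZMod 2 → Submodule K L) (br : L →ₗ[K] L →ₗ[K] L) : Prop where
  internal : DirectSum.IsInternal A
  graded : ∀ i j : ZMod 2, ∀ a ∈ A i, ∀ b ∈ A j, br a b ∈ A (i + j)
  skew : ∀ i j : ZMod 2, ∀ a ∈ A i, ∀ b ∈ A j, br a b = -(koszul K i j • br b a)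
  jacobi : ∀ i j : ZMod 2, ∀ a ∈ A i, ∀ b ∈ A j, ∀ c : L,
    br a (br b c) = br (br a b) c + koszul K i j • br b (br a c)
  odd_cube : ∀ a ∈ A 1, br a (br a a) = 0

/-- `B` is a non-degenerate invariant symmetric bilinear form of parity `q`. -/
structure IsNIS (A : ZMod 2 → Submodule K L) (br : L →ₗ[K] L →ₗ[K] L)
    (B : L →ₗ[K] L →ₗ[K] K) (q : ZMod 2) : Prop where
  parity : ∀ i j : ZMod 2, ∀ a ∈ A i, ∀ b ∈ A j, i + j ≠ q → B a b = 0
  symm : ∀ i j : ZMod 2, ∀ a ∈ A i, ∀ b ∈ A j, B b a = koszul K i j * B a b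
  invariant : ∀ a b c : L, B (br a b) c = B a (br b c)
  nondegenerate : B.Nondegenerate

/-- `adCoeff br a b n k` is the coefficient of `t ^ k` in `(ad_{t a + b}) ^ n (a)`. -/
def adCoeff (br : L →ₗ[K] L →ₗ[K] L) (a b : L) : ℕ → ℕ → L
  | 0, 0 => a
  | 0, _ + 1 => 0
  | n + 1, 0 => br b (adCoeff br a b n 0)
  | n + 1, k + 1 => br b (adCoeff br a b n (k + 1)) + br a (adCoeff br a b n k)

/-- Jacobson's terms, `(ad_{t a + b}) ^ (p - 1) (a) = ∑ i, i s_i(a, b) t ^ (i - 1)`,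
the sum being over `1 ≤ i ≤ p - 1`. -/
def jacobsonTerm (p : ℕ) (br : L →ₗ[K] L →ₗ[K] L) (i : ℕ) (a b : L) : L :=
  (i : K)⁻¹ • adCoeff br a b (p - 1) (i - 1)

/-- `sigmaCoeff br B D a b n k` is the coefficient of `t ^ k` in
`B (D (t a + b)) ((ad_{t a + b}) ^ n (a))`. -/
def sigmaCoeff (br : L →ₗ[K] L →ₗ[K] L) (B : L →ₗ[K] L →ₗ[K] K) (D : L →ₗ[K] L)
    (a b : L) (n : ℕ) : ℕ → K
  | 0 => B (D b) (adCoeff br a b n 0)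
  | k + 1 => B (D b) (adCoeff br a b n (k + 1)) + B (D a) (adCoeff br a b n k)

/-- The terms
`B (D (t a + b)) ((ad_{t a + b}) ^ (p - 2) (a)) = ∑ i, i σ_i(a, b) t ^ (i - 1)`,
the sum being over `1 ≤ i ≤ p - 1`. -/
def sigmaTerm (p : ℕ) (br : L →ₗ[K] L →ₗ[K] L) (B : L →ₗ[K] L →ₗ[K] K) (D : L →ₗ[K] L)
    (i : ℕ) (a b : L) : K :=
  (i : K)⁻¹ * sigmaCoeff br B D a b (p - 2) (i - 1)

/-- `(A, br)` is a Lie superalgebra and `pm`, the map `a ↦ a^{[p]}` on the even part, is a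
`p|2p`-structure on it. (The map `[2p]` on the odd part is `a ↦ ((1/2) [a,a])^{[p]}`, hence is
determined by `pm`.) -/
structure IsRestrictedLieSuperalgebra (p : ℕ) (A : ZMod 2 → Submodule K L)
    (br : L →ₗ[K] L →ₗ[K] L) (pm : A 0 → A 0) : Prop extends IsLieSuperalgebra A br where
  ad_pow : ∀ (a : A 0) (b : L), br (pm a) b = (br a)^[p] b
  smul_pow : ∀ (c : K) (a : A 0), pm (c • a) = c ^ p • pm a
  add_pow : ∀ a b : A 0, (pm (a + b) : L) =
    pm a + pm b + ∑ i ∈ Finset.Icc 1 (p - 1), jacobsonTerm p br i (a : L) (b : L)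

/-- `D` is a homogeneous derivation of parity `d` that is restricted with respect to `pm`. -/
structure IsRestrictedDerivation (p : ℕ) (A : ZMod 2 → Submodule K L)
    (br : L →ₗ[K] L →ₗ[K] L) (pm : A 0 → A 0) (d : ZMod 2) (D : L →ₗ[K] L) : Prop where
  graded : ∀ i : ZMod 2, ∀ a ∈ A i, D a ∈ A (i + d)
  leibniz : ∀ i : ZMod 2, ∀ a ∈ A i, ∀ b : L,
    D (br a b) = br (D a) b + koszul K d i • br a (D b)
  restricted : ∀ a : A 0, D (pm a) = (br a)^[p - 1] (D a)

/-- `B` is `D`-invariant, for `D` of parity `d` (characteristic different from 2). -/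
def IsDInvariant (A : ZMod 2 → Submodule K L) (B : L →ₗ[K] L →ₗ[K] K) (d : ZMod 2)
    (D : L →ₗ[K] L) : Prop :=
  ∀ i : ZMod 2, ∀ a ∈ A i, ∀ b : L, B (D a) b + koszul K d i * B a (D b) = 0

/-- The conditions on the map `P` on the even part: `P (c a) = c ^ p P (a)` and
`P (a + b) - P a - P b = ∑ i, σ_i (a, b)`, the sum being over `1 ≤ i ≤ p - 1`. -/
structure IsSigmaMap (p : ℕ) (A : ZMod 2 → Submodule K L) (br : L →ₗ[K] L →ₗ[K] L)
    (B : L →ₗ[K] L →ₗ[K] K) (D : L →ₗ[K] L) (P : A 0 → K) : Prop where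
  smul : ∀ (c : K) (a : A 0), P (c • a) = c ^ p * P a
  add : ∀ a b : A 0, P (a + b) - P a - P b =
    ∑ i ∈ Finset.Icc 1 (p - 1), sigmaTerm p br B D i (a : L) (b : L)

/-- The linear map `a ↦ (-1)^{d p(a)} a`. -/
noncomputable def parityOp {A : ZMod 2 → Submodule K L} (hA : DirectSum.IsInternal A)
    (d : ZMod 2) : L →ₗ[K] L :=
  letI := hA.chooseDecomposition
  DirectSum.toModule K (ZMod 2) L (fun i => koszul K d i • (A i).subtype) ∘ₗ
    (DirectSum.decomposeLinearEquiv A).toLinearMap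

theorem parityOp_apply {A : ZMod 2 → Submodule K L} (hA : DirectSum.IsInternal A)
    (d i : ZMod 2) (a : L) (ha : a ∈ A i) : parityOp hA d a = koszul K d i • a := by
  letI := hA.chooseDecomposition
  have h : DirectSum.decompose A a = DirectSum.lof K (ZMod 2) (fun i => A i) i ⟨a, ha⟩ :=
    DirectSum.decompose_of_mem A ha
  simp only [parityOp, LinearMap.comp_apply, LinearEquiv.coe_coe,
    DirectSum.decomposeLinearEquiv_apply]
  rw [h, DirectSum.toModule_lof]
  rfl

theorem adCoeff_eq_zero (br : L →ₗ[K] L →ₗ[K] L) (a b : L) (n k : ℕ) (h : n < k) :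
    adCoeff br a b n k = 0 := by
  induction n generalizing k with
  | zero => cases k with
    | zero => omega
    | succ k => rfl
  | succ n ih => cases k with
    | zero => omega
    | succ k => simp [adCoeff, ih (k + 1) (by omega), ih k (by omega)]

theorem iterate_eq_sum_adCoeff (br : L →ₗ[K] L →ₗ[K] L) (a b : L) (t : K) (n : ℕ) :
    (br (t • a + b))^[n] a = ∑ k ∈ Finset.range (n + 1), t ^ k • adCoeff br a b n k := by
  induction n with
  | zero => simp [adCoeff]
  | succ n ih =>
    rw [Function.iterate_succ_apply', ih, Finset.sum_range_succ' _ (n + 1)]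
    simp only [adCoeff, smul_add, Finset.sum_add_distrib, map_add, LinearMap.add_apply, map_sum,
      map_smul, LinearMap.smul_apply, pow_zero, one_smul]
    have h1 : ∑ k ∈ Finset.range (n + 1), t ^ k • br b (adCoeff br a b n k) =
        ∑ k ∈ Finset.range (n + 1), t ^ (k + 1) • br b (adCoeff br a b n (k + 1)) +
          br b (adCoeff br a b n 0) := by
      have := Finset.sum_range_succ' (fun k => t ^ k • br b (adCoeff br a b n k)) (n + 1)
      rw [Finset.sum_range_succ, adCoeff_eq_zero br a b n (n + 1) (by omega)] at this
      simpa using this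
    rw [h1]
    simp only [smul_smul, pow_succ]
    abel

theorem form_iterate_eq_sum_sigmaCoeff (br : L →ₗ[K] L →ₗ[K] L) (B : L →ₗ[K] L →ₗ[K] K)
    (D : L →ₗ[K] L) (a b : L) (t : K) (n : ℕ) :
    B (D (t • a + b)) ((br (t • a + b))^[n] a) =
      ∑ k ∈ Finset.range (n + 2), t ^ k * sigmaCoeff br B D a b n k := by
  rw [iterate_eq_sum_adCoeff, Finset.sum_range_succ' _ (n + 1)]
  have h1 : ∑ k ∈ Finset.range (n + 1), t ^ k * B (D b) (adCoeff br a b n k) =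
      ∑ k ∈ Finset.range (n + 1), t ^ (k + 1) * B (D b) (adCoeff br a b n (k + 1)) +
        B (D b) (adCoeff br a b n 0) := by
    have := Finset.sum_range_succ' (fun k => t ^ k * B (D b) (adCoeff br a b n k)) (n + 1)
    rw [Finset.sum_range_succ, adCoeff_eq_zero br a b n (n + 1) (by omega)] at this
    simpa using this
  simp only [sigmaCoeff, map_add, map_smul, map_sum, LinearMap.add_apply, LinearMap.smul_apply,
    smul_eq_mul, pow_zero, one_mul, mul_add, Finset.sum_add_distrib, h1]
  simp only [pow_succ]
  have h3 : ∀ k, t ^ k * (t * B (D a) (adCoeff br a b n k)) =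
      t ^ k * t * B (D a) (adCoeff br a b n k) := fun k => by ring
  simp only [h3]
  ring

end Super

/-! ### The double extension `K x ⊕ L ⊕ K x*`, realized on `K × L × K` -/

namespace DoubleExt

variable {K L : Type*} [Field K] [AddCommGroup L] [Module K L]

/-- The basis vector `x` of the first summand. -/
def x : K × L × K := (1, 0, 0)

/-- The basis vector `x*` of the last summand. -/
def xs : K × L × K := (0, 0, 1)

/-- The inclusion of `L`. -/
def ofL (a : L) : K × L × K := (0, a, 0)

/-- The parity of the double extension when the form is odd: `p(x*) = d` and `p(x) = d + 1`,
where `d` is the parity of the derivation. -/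
def grading (A : ZMod 2 → Submodule K L) (d i : ZMod 2) : Submodule K (K × L × K) :=
  (if i = d + 1 then ⊤ else ⊥ : Submodule K K).prod
    ((A i).prod (if i = d then ⊤ else ⊥ : Submodule K K))

/-- The form on the double extension: it extends `B`, pairs `x` and `x*` to `1`, and vanishes on
the other pairs. -/
def form (B : L →ₗ[K] L →ₗ[K] K) : (K × L × K) →ₗ[K] (K × L × K) →ₗ[K] K :=
  LinearMap.mk₂ K (fun g h => B g.2.1 h.2.1 + g.1 * h.2.2 + g.2.2 * h.1)
    (by intros; simp; ring) (by intros; simp; ring) (by intros; simp; ring) (by intros; simp; ring)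

/-- The bilinear bracket with `x` central, `[a, b] = [a, b]_L + B (D a) b x`,
`[x*, a] = D a + φ a x`, `[a, x*] = -(-1)^{d p(a)} [x*, a]` and `[x*, x*] = w + l x`. -/
noncomputable def bracket {A : ZMod 2 → Submodule K L} (hA : DirectSum.IsInternal A)
    (br : L →ₗ[K] L →ₗ[K] L) (B : L →ₗ[K] L →ₗ[K] K) (d : ZMod 2) (D : L →ₗ[K] L)
    (φ : L →ₗ[K] K) (w : L) (l : K) : (K × L × K) →ₗ[K] (K × L × K) →ₗ[K] (K × L × K) :=
  LinearMap.mk₂ K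
    (fun g h =>
      (B (D g.2.1) h.2.1 + g.2.2 * φ h.2.1 - h.2.2 * φ (parityOp hA d g.2.1) + g.2.2 * h.2.2 * l,
        br g.2.1 h.2.1 + g.2.2 • D h.2.1 - h.2.2 • D (parityOp hA d g.2.1) + (g.2.2 * h.2.2) • w,
        0))
    (by intros; ext <;> simp <;> first | ring1 | module)
    (by intros; ext <;> simp <;> first | ring1 | module)
    (by intros; ext <;> simp <;> first | ring1 | module)
    (by intros; ext <;> simp <;> first | ring1 | module)

/-- The bracket for an odd form and an odd derivation `D` with `D ^ 2 = ad b₀`: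
`[x*, a] = D a - (-1)^{p(a)} 2 B(a, b₀) x` and `[x*, x*] = 2 b₀ + l x`. -/
noncomputable def oddBracket {A : ZMod 2 → Submodule K L} (hA : DirectSum.IsInternal A)
    (br : L →ₗ[K] L →ₗ[K] L) (B : L →ₗ[K] L →ₗ[K] K) (D : L →ₗ[K] L) (b₀ : L) (l : K) :
    (K × L × K) →ₗ[K] (K × L × K) →ₗ[K] (K × L × K) :=
  bracket hA br B 1 D (-((2 : K) • (B.flip b₀ ∘ₗ parityOp hA 1))) ((2 : K) • b₀) l

/-- The bracket for an odd form and an even derivation `D`: `[x*, a] = D a`, `[x*, x*] = 0`. -/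
noncomputable def evenBracket {A : ZMod 2 → Submodule K L} (hA : DirectSum.IsInternal A)
    (br : L →ₗ[K] L →ₗ[K] L) (B : L →ₗ[K] L →ₗ[K] K) (D : L →ₗ[K] L) :
    (K × L × K) →ₗ[K] (K × L × K) →ₗ[K] (K × L × K) :=
  bracket hA br B 0 D 0 0 0

theorem oddBracket_xs_ofL {A : ZMod 2 → Submodule K L} (hA : DirectSum.IsInternal A)
    (br : L →ₗ[K] L →ₗ[K] L) (B : L →ₗ[K] L →ₗ[K] K) (D : L →ₗ[K] L) (b₀ : L) (l : K)
    (i : ZMod 2) (a : L) (ha : a ∈ A i) :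
    oddBracket hA br B D b₀ l xs (ofL a) = ofL (D a) - (koszul K 1 i * (2 * B a b₀)) • x := by
  ext <;> simp [oddBracket, bracket, xs, ofL, x, parityOp_apply hA 1 i a ha]
  ring

theorem oddBracket_xs_xs {A : ZMod 2 → Submodule K L} (hA : DirectSum.IsInternal A)
    (br : L →ₗ[K] L →ₗ[K] L) (B : L →ₗ[K] L →ₗ[K] K) (D : L →ₗ[K] L) (b₀ : L) (l : K) :
    oddBracket hA br B D b₀ l xs xs = (2 : K) • ofL b₀ + l • x := by
  ext <;> simp [oddBracket, bracket, xs, ofL, x]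

theorem ofL_mem (A : ZMod 2 → Submodule K L) (d i : ZMod 2) (a : A i) :
    ofL (a : L) ∈ grading A d i := by
  simp [ofL, grading]

theorem x_mem (A : ZMod 2 → Submodule K L) : x ∈ grading A 1 0 := by
  have h : (0 : ZMod 2) = 1 + 1 := by decide
  simp [x, grading, ← h]

theorem xs_mem (A : ZMod 2 → Submodule K L) : xs ∈ grading A 0 0 := by
  simp [xs, grading]

end DoubleExt

/-! The Lie superalgebra axioms are checked on homogeneous elements. Invariance of the form on the
double extension forces the x-component B(D a, b) of a bracket, and this is a 2-cocycle because D is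
a derivation that leaves B invariant. In the odd case D² = ad b₀ and D b₀ = 0 make x* fit.

For the p-map, let S(a, b) be the sum of Jacobson's terms (`jacobsonSum`). On the even part, S is
symmetric, satisfies the 2-cocycle identity, is homogeneous of degree p and vanishes on pairs of
multiples of one vector; moreover ad S(a, b) = (ad_{a+b})^p - (ad_a)^p - (ad_b)^p. Symmetry and the
cocycle identity are proved inside the Lie algebra H, without an enveloping algebra. A derivation δ
sends S(a, b) to the coboundary of u ↦ (ad_u)^(p-1)(δ u) (`derivation_jacobsonSum`). With δ = d/dX
on K[X] ⊗ H, the defect of either identity, with a replaced by aX, has derivative 0. Its degree is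
below p, so it is constant, and it vanishes at X = 0.

Since D is restricted and B is odd, (ad_a)^p on the double extension is the bracket with a^{[p]} for
even a (`iterate_bracket_prime`). If D is odd, the even part is Kx ⊕ 𝔞₀ and the x-component of S is
the sum of the σ_i. That sum is therefore a cocycle, and by `exists_homogeneous_of_cocycle` it is a
coboundary, which gives 𝒫; the p-map is then written down on Kx and 𝔞₀ separately. If D is even, the
even part is 𝔞₀ ⊕ Kx*, and the law for sums forces a + t x* ↦ a^{[p]} + t^p (γ x* + a₀) + S(a, t
x*); that this map obeys the law in general is a consequence of the cocycle identity. -/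

/-! ### Jacobson's formula for p-th powers in associative algebras -/

section JacobsonFormula

theorem map_adCoeff {K L M : Type*} [Field K] [AddCommGroup L] [Module K L] [AddCommGroup M]
    [Module K M] {br : L →ₗ[K] L →ₗ[K] L} {br' : M →ₗ[K] M →ₗ[K] M} (f : L →ₗ[K] M)
    (hf : ∀ a b, f (br a b) = br' (f a) (f b)) (a b : L) (n k : ℕ) :
    f (adCoeff br a b n k) = adCoeff br' (f a) (f b) n k := by
  induction n generalizing k with
  | zero => cases k <;> simp [adCoeff]
  | succ n ih => cases k <;> simp [adCoeff, hf, ih]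

/-- The sum of Jacobson's terms. -/
def jacobsonSum {K L : Type*} [Field K] [AddCommGroup L] [Module K L] (p : ℕ)
    (br : L →ₗ[K] L →ₗ[K] L) (a b : L) : L :=
  ∑ i ∈ Finset.Icc 1 (p - 1), jacobsonTerm p br i a b

theorem map_jacobsonSum {K L M : Type*} [Field K] [AddCommGroup L] [Module K L] [AddCommGroup M]
    [Module K M] {br : L →ₗ[K] L →ₗ[K] L} {br' : M →ₗ[K] M →ₗ[K] M} (f : L →ₗ[K] M)
    (hf : ∀ a b, f (br a b) = br' (f a) (f b)) (p : ℕ) (a b : L) :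
    f (jacobsonSum p br a b) = jacobsonSum p br' (f a) (f b) := by
  simp [jacobsonSum, jacobsonTerm, map_adCoeff f hf]

theorem adCoeff_eq_zero_of_br_eq_zero {K L : Type*} [Field K] [AddCommGroup L] [Module K L]
    (br : L →ₗ[K] L →ₗ[K] L) {a b : L} (haa : br a a = 0) (hba : br b a = 0) {n : ℕ} (hn : 0 < n)
    (k : ℕ) : adCoeff br a b n k = 0 := by
  induction n, hn using Nat.le_induction generalizing k with
  | base => rcases k with _ | _ | k <;> simp [adCoeff, haa, hba]
  | succ n _ ih => cases k <;> simp [adCoeff, ih]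

theorem adCoeff_smul_smul {K L : Type*} [Field K] [AddCommGroup L] [Module K L]
    (br : L →ₗ[K] L →ₗ[K] L) (c : K) (a b : L) (n k : ℕ) :
    adCoeff br (c • a) (c • b) n k = c ^ (n + 1) • adCoeff br a b n k := by
  induction n generalizing k with
  | zero => cases k <;> simp [adCoeff]
  | succ n ih => cases k <;> simp [adCoeff, ih, smul_smul, pow_succ' c (n + 1), mul_comm]

theorem jacobsonSum_eq_zero {K L : Type*} [Field K] [AddCommGroup L] [Module K L] {p : ℕ}
    (hp : 1 < p) (br : L →ₗ[K] L →ₗ[K] L) {a b : L} (haa : br a a = 0) (hba : br b a = 0) :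
    jacobsonSum p br a b = 0 := by
  simp [jacobsonSum, jacobsonTerm, adCoeff_eq_zero_of_br_eq_zero br haa hba (Nat.sub_pos_of_lt hp)]

theorem jacobsonSum_smul_smul {K L : Type*} [Field K] [AddCommGroup L] [Module K L] {p : ℕ}
    (hp : 0 < p) (br : L →ₗ[K] L →ₗ[K] L) (c : K) (a b : L) :
    jacobsonSum p br (c • a) (c • b) = c ^ p • jacobsonSum p br a b := by
  simp only [jacobsonSum, jacobsonTerm, adCoeff_smul_smul, Nat.sub_add_cancel hp, Finset.smul_sum]
  exact Finset.sum_congr rfl fun i _ => smul_comm _ _ _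

/-- The commutator of an associative algebra. -/
def commutator₂ (K E : Type*) [Field K] [Ring E] [Algebra K E] : E →ₗ[K] E →ₗ[K] E :=
  LinearMap.mul K E - (LinearMap.mul K E).flip

@[simp]
theorem commutator₂_apply {K E : Type*} [Field K] [Ring E] [Algebra K E] (a b : E) :
    commutator₂ K E a b = a * b - b * a := rfl

/-- By Pascal's rule, consecutive binomials C(p-1, i) and C(p-1, i+1) add up to C(p, i+1), which is
divisible by p. The hypothesis p = 0 in R, unlike `CharP R p`, also covers the zero ring. -/
theorem natCast_choose_pred_prime {R : Type*} [Ring R] (p : ℕ) [Fact p.Prime]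
    (hR : (p : R) = 0) {i : ℕ} (hi : i < p) : (((p - 1).choose i : ℕ) : R) = (-1) ^ i := by
  induction i with
  | zero => simp
  | succ i ih =>
    have hp : 0 < p := (Fact.out : p.Prime).pos
    have h := Nat.choose_succ_succ (p - 1) i
    rw [Nat.succ_eq_add_one, Nat.sub_add_cancel hp] at h
    obtain ⟨m, hm⟩ := (Fact.out : p.Prime).dvd_choose_self (k := i + 1) (by omega) hi
    have h2 : ((p.choose (i + 1) : ℕ) : R) = 0 := by rw [hm, Nat.cast_mul, hR, zero_mul]
    rw [h, Nat.cast_add, ih (by omega)] at h2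
    rw [pow_succ, mul_neg_one]
    exact (neg_eq_of_add_eq_zero_right h2).symm

/-- The signs of the binomials C(p-1, i) cancel those of the powers of -y. -/
theorem Commute.sub_pow_pred_prime {R : Type*} [Ring R] (p : ℕ) [Fact p.Prime]
    (hR : (p : R) = 0) {x y : R} (h : Commute x y) :
    (x - y) ^ (p - 1) = ∑ i ∈ Finset.range p, x ^ i * y ^ (p - 1 - i) := by
  have hp : 0 < p := (Fact.out : p.Prime).pos
  rw [sub_eq_neg_add, (h.symm.neg_left).add_pow, Nat.sub_add_cancel hp,
    ← Finset.sum_range_reflect]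
  refine Finset.sum_congr rfl fun i hi => ?_
  have hi' : i < p := Finset.mem_range.1 hi
  have hsq : ((-1 : R) ^ (p - 1 - i)) * (-1) ^ (p - 1 - i) = 1 := by
    rw [← pow_add]; exact (Even.add_self _).neg_one_pow
  have hc : Commute ((-1 : R) ^ (p - 1 - i)) (y ^ (p - 1 - i) * x ^ i) :=
    (Commute.neg_one_left _).pow_left _
  rw [natCast_choose_pred_prime p hR (by omega : p - 1 - i < p), neg_pow,
    show p - 1 - (p - 1 - i) = i by omega, mul_assoc ((-1 : R) ^ (p - 1 - i)), hc.eq, mul_assoc,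
    hsq, mul_one, (h.symm.pow_pow _ _).eq]

open Polynomial in
theorem derivative_pow_eq_sum {E : Type*} [Ring E] (u : E[X]) (n : ℕ) :
    derivative (u ^ n) = ∑ i ∈ Finset.range n, u ^ i * derivative u * u ^ (n - 1 - i) := by
  induction n with
  | zero => simp
  | succ n ih =>
    rw [pow_succ, derivative_mul, ih, Finset.sum_range_succ, Finset.sum_mul]
    congr 1
    · refine Finset.sum_congr rfl fun i hi => ?_
      have := Finset.mem_range.1 hi
      rw [mul_assoc, ← pow_succ, show n - 1 - i + 1 = n + 1 - 1 - i by omega]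
    · rw [show n + 1 - 1 - n = 0 by omega, pow_zero, mul_one]

/-- Left and right multiplication by u commute and their difference is ad u, so
`Commute.sub_pow_pred_prime` applies in the endomorphism ring. -/
theorem sum_pow_mul_mul_pow_eq_iterate {E : Type*} [Ring E] (p : ℕ) [Fact p.Prime]
    (hE : (p : E) = 0) (u c : E) : ∑ i ∈ Finset.range p, u ^ i * c * u ^ (p - 1 - i) =
      (fun y => u * y - y * u)^[p - 1] c := by
  have hR : ((p : ℕ) : Module.End ℤ E) = 0 := by
    ext y
    rw [Module.End.natCast_apply, nsmul_eq_mul, hE, zero_mul, LinearMap.zero_apply]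
  have h := Commute.sub_pow_pred_prime p hR (x := LinearMap.mulLeft ℤ u)
    (y := LinearMap.mulRight ℤ u) (LinearMap.commute_mulLeft_right u u)
  have h2 := LinearMap.congr_fun h c
  rw [Module.End.pow_apply] at h2
  have h3 : (⇑(LinearMap.mulLeft ℤ u - LinearMap.mulRight ℤ u)) = fun y => u * y - y * u := rfl
  rw [← h3, h2]
  simp [LinearMap.sum_apply, mul_assoc]

open Polynomial in
theorem coeff_iterate_commutator {K E : Type*} [Field K] [Ring E] [Algebra K E] (a b : E)
    (n k : ℕ) : ((fun y => (C a * X + C b) * y - y * (C a * X + C b))^[n] (C a)).coeff k =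
      adCoeff (commutator₂ K E) a b n k := by
  induction n generalizing k with
  | zero => cases k <;> simp [adCoeff, coeff_C]
  | succ n ih =>
    have h : ∀ q : E[X], (C a * X + C b) * q - q * (C a * X + C b) =
        (C a * q - q * C a) * X + (C b * q - q * C b) := fun q => by
      have := X_mul (p := q)
      simp only [add_mul, mul_add, sub_mul, mul_assoc, this]
      abel
    rw [Function.iterate_succ_apply', h]
    cases k with
    | zero =>
      simp only [coeff_add, coeff_sub, mul_coeff_zero, coeff_C_zero, coeff_X_zero, mul_zero,
        zero_add, ih, adCoeff, commutator₂_apply]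
    | succ k =>
      simp only [coeff_add, coeff_sub, coeff_C_mul, coeff_mul_C, coeff_mul_X, ih, adCoeff,
        commutator₂_apply]
      exact add_comm _ _

open Polynomial in
/-- Jacobson's formula. -/
theorem add_pow_eq_jacobsonSum {K E : Type*} [Field K] [Ring E] [Algebra K E] (p : ℕ)
    [Fact p.Prime] [CharP K p] (a b : E) :
    (a + b) ^ p = a ^ p + b ^ p + jacobsonSum p (commutator₂ K E) a b := by
  have hp : 0 < p := (Fact.out : p.Prime).pos
  have hE : (p : E) = 0 := by
    rw [← map_natCast (algebraMap K E), CharP.cast_eq_zero, map_zero]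
  have hEX : (p : E[X]) = 0 := by rw [← C_eq_natCast, hE, C_0]
  set u : E[X] := C a * X + C b with hu
  -- The noncommutative power rule produces ∑ u^i a u^(p-1-i), which in characteristic p is
  -- (ad_u)^(p-1)(a). Its coefficients are those in Jacobson's terms.
  have hder : derivative (u ^ p) = (fun y => u * y - y * u)^[p - 1] (C a) := by
    rw [derivative_pow_eq_sum, ← sum_pow_mul_mul_pow_eq_iterate p hEX]
    simp [hu]
  have hdeg : u.natDegree ≤ 1 := natDegree_linear_le
  have hdegp : (u ^ p).natDegree < p + 1 :=
    Nat.lt_succ_of_le ((natDegree_pow_le_of_le p hdeg).trans (by omega))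
  have htop : (u ^ p).coeff p = a ^ p := by
    have := coeff_pow_of_natDegree_le (m := p) hdeg
    simpa [hu] using this
  have hzero : (u ^ p).coeff 0 = b ^ p := by
    have h := map_pow (constantCoeff (R := E)) u p
    simpa [hu] using h
  -- Evaluation is multiplicative here although E is not commutative, because the point 1 is
  -- central.
  have hone : (u ^ p).eval 1 = (a + b) ^ p := by
    have h := map_pow (eval₂RingHom' (RingHom.id E) 1 fun _ => Commute.one_right _) u p
    simpa [eval₂RingHom', hu, eval₂_eq_eval_map] using h
  -- The coefficient of X^(i-1) in the derivative of u^p is i times the coefficient of X^i in u^p,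
  -- and i is invertible for 0 < i < p.
  have hmid : ∀ i ∈ Finset.Icc 1 (p - 1),
      (u ^ p).coeff i = jacobsonTerm p (commutator₂ K E) i a b := by
    intro i hi
    obtain ⟨h1, h2⟩ := Finset.mem_Icc.1 hi
    have hi0 : (i : K) ≠ 0 := by
      rw [Ne, CharP.cast_eq_zero_iff K p]
      exact fun h => absurd (Nat.le_of_dvd h1 h) (by omega)
    have h := congrArg (fun q => coeff q (i - 1)) hder
    simp only [coeff_derivative] at h
    rw [coeff_iterate_commutator (K := K), Nat.sub_add_cancel h1] at h
    rw [jacobsonTerm, ← h, eq_inv_smul_iff₀ hi0, Nat.cast_smul_eq_nsmul, nsmul_eq_mul,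
      ← Nat.cast_succ, Nat.succ_eq_add_one, Nat.sub_add_cancel h1, Nat.cast_comm]
  rw [← hone, eval_eq_sum_range' hdegp, Finset.sum_range_succ, ← Nat.sub_add_cancel hp,
    Finset.sum_range_succ', Nat.sub_add_cancel hp, jacobsonSum, Finset.range_eq_Ico,
    Finset.sum_Ico_add' (fun i => (u ^ p).coeff i * 1 ^ i) 0 (p - 1) 1]
  simp only [one_pow, mul_one, htop, hzero]
  rw [add_comm, ← add_assoc, add_assoc, add_assoc, add_right_inj, add_comm, add_right_inj]
  exact Finset.sum_congr (by ext; simp) hmid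

end JacobsonFormula

/-! ### Symmetry and cocycle identity of Jacobson's sum in a Lie algebra -/

section Cocycle

open scoped TensorProduct
open Polynomial

/-- A map into an associative algebra that carries brackets to commutators carries Jacobson's sum to
that of the algebra, where Jacobson's formula computes it. -/
theorem map_jacobsonSum_eq_sub {K H E : Type*} [Field K] [AddCommGroup H] [Module K H] [Ring E]
    [Algebra K E] (p : ℕ) [Fact p.Prime] [CharP K p] {br : H →ₗ[K] H →ₗ[K] H} (ρ : H →ₗ[K] E)
    (hρ : ∀ a b, ρ (br a b) = ρ a * ρ b - ρ b * ρ a) (a b : H) :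
    ρ (jacobsonSum p br a b) = ρ (a + b) ^ p - ρ a ^ p - ρ b ^ p := by
  rw [map_jacobsonSum (br' := commutator₂ K E) ρ hρ, map_add, add_pow_eq_jacobsonSum (K := K) p]
  abel

/-- The bracket of a Lie algebra as a bilinear map. -/
def lieBr (K H : Type*) [Field K] [LieRing H] [LieAlgebra K H] : H →ₗ[K] H →ₗ[K] H :=
  (LieAlgebra.ad K H : H →ₗ[K] Module.End K H)

theorem lieBr_apply {K H : Type*} [Field K] [LieRing H] [LieAlgebra K H] (a b : H) :
    lieBr K H a b = ⁅a, b⁆ := rfl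

theorem lieBr_swap {K H : Type*} [Field K] [LieRing H] [LieAlgebra K H] (a b : H) :
    lieBr K H a b = -lieBr K H b a := (lie_skew a b).symm

theorem lieBr_lieBr {K H : Type*} [Field K] [LieRing H] [LieAlgebra K H] (a b c : H) :
    lieBr K H (lieBr K H a b) c = lieBr K H a (lieBr K H b c) - lieBr K H b (lieBr K H a c) :=
  lie_lie a b c

/-- Jacobson's formula for the value of a derivation on the sum of Jacobson's terms. -/
theorem derivation_jacobsonSum {K H : Type*} [Field K] [LieRing H] [LieAlgebra K H] (p : ℕ)
    [Fact p.Prime] [CharP K p] (δ : H →ₗ[K] H)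
    (hδ : ∀ a b, δ (lieBr K H a b) = lieBr K H (δ a) b + lieBr K H a (δ b)) (a b : H) :
    δ (jacobsonSum p (lieBr K H) a b) = (lieBr K H (a + b))^[p - 1] (δ (a + b)) -
      (lieBr K H a)^[p - 1] (δ a) - (lieBr K H b)^[p - 1] (δ b) := by
  have hp : 0 < p := (Fact.out : p.Prime).pos
  -- As δ is a 1-cocycle of the adjoint representation, H acts on H × K. The vector (0, 1) is sent
  -- by ρ u to -δ u and by (ρ u)^p to -(ad_u)^(p-1)(δ u), so Jacobson's formula for ρ, read at (0,
  -- 1), is the claim.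
  let ρ : H →ₗ[K] Module.End K (H × K) := LinearMap.mk₂ K
    (fun u z => (lieBr K H u z.1 - z.2 • δ u, 0))
    (by intros; ext <;> simp; abel) (by intros; ext <;> simp [smul_sub]; rw [smul_comm])
    (by intros; ext <;> simp [add_smul]; abel) (by intros; ext <;> simp [smul_sub, smul_smul])
  have hρ : ∀ u z, ρ u z = (lieBr K H u z.1 - z.2 • δ u, 0) := fun _ _ => rfl
  have hmul : ∀ u v, ρ (lieBr K H u v) = ρ u * ρ v - ρ v * ρ u := by
    intro u v
    refine LinearMap.ext fun z => Prod.ext ?_ ?_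
    · simp only [hρ, hδ, Module.End.mul_apply, LinearMap.sub_apply, Prod.fst_sub, zero_smul,
        sub_zero, map_sub, map_smul, lieBr_lieBr, smul_add, lieBr_swap (δ u) v, smul_neg]
      abel
    · simp [hρ]
  have hpow : ∀ (u : H) (n : ℕ), (ρ u ^ (n + 1)) (0, 1) = (-(lieBr K H u)^[n] (δ u), 0) := by
    intro u n
    induction n with
    | zero => simp [hρ]
    | succ n ih =>
      rw [pow_succ', Module.End.mul_apply, ih, Function.iterate_succ_apply']
      simp [hρ]
  have h := congrArg Prod.fst
    (LinearMap.congr_fun (map_jacobsonSum_eq_sub p ρ hmul a b) (0, 1))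
  have hq : p - 1 + 1 = p := Nat.sub_add_cancel hp
  simp only [LinearMap.sub_apply] at h
  rw [← hq, hpow, hpow, hpow, hq, hρ] at h
  simp only [map_zero, one_smul, zero_sub, Prod.fst_sub] at h
  rw [← neg_inj, h]
  abel

theorem lieBr_tmul {K H : Type*} [Field K] [LieRing H] [LieAlgebra K H] (f g : K[X]) (a b : H) :
    lieBr K (K[X] ⊗[K] H) (f ⊗ₜ a) (g ⊗ₜ b) = (f * g) ⊗ₜ[K] lieBr K H a b := rfl

/-- The polynomials of degree at most `n` with coefficients in `H`. -/
noncomputable def polyLE (K H : Type*) [Field K] [AddCommGroup H] [Module K H] (n : ℕ) :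
    Submodule K (K[X] ⊗[K] H) :=
  Submodule.span K {z | ∃ i ≤ n, ∃ h : H, z = (X ^ i : K[X]) ⊗ₜ[K] h}

theorem pow_tmul_mem_polyLE {K H : Type*} [Field K] [AddCommGroup H] [Module K H] {i n : ℕ}
    (h : i ≤ n) (a : H) : (X ^ i : K[X]) ⊗ₜ[K] a ∈ polyLE K H n :=
  Submodule.subset_span ⟨i, h, a, rfl⟩

theorem lieBr_mem_polyLE {K H : Type*} [Field K] [LieRing H] [LieAlgebra K H] {m n : ℕ}
    {y z : K[X] ⊗[K] H} (hy : y ∈ polyLE K H m) (hz : z ∈ polyLE K H n) :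
    lieBr K (K[X] ⊗[K] H) y z ∈ polyLE K H (m + n) := by
  induction hy, hz using Submodule.span_induction₂ with
  | mem_mem y z hy hz =>
    obtain ⟨i, hi, a, rfl⟩ := hy
    obtain ⟨j, hj, b, rfl⟩ := hz
    rw [lieBr_tmul, ← pow_add]
    exact pow_tmul_mem_polyLE (by omega) _
  | zero_left => simp
  | zero_right => simp
  | add_left _ _ _ _ _ _ h1 h2 => rw [map_add, LinearMap.add_apply]; exact add_mem h1 h2
  | add_right _ _ _ _ _ _ h1 h2 => rw [map_add]; exact add_mem h1 h2
  | smul_left c _ _ _ _ h => rw [map_smul, LinearMap.smul_apply]; exact Submodule.smul_mem _ _ h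
  | smul_right c _ _ _ _ h => rw [map_smul]; exact Submodule.smul_mem _ _ h

/-- The derivative of polynomials with coefficients in `H`. -/
noncomputable def polyDeriv (K H : Type*) [Field K] [AddCommGroup H] [Module K H] :
    K[X] ⊗[K] H →ₗ[K] K[X] ⊗[K] H :=
  (derivative (R := K)).rTensor H

@[simp]
theorem polyDeriv_tmul {K H : Type*} [Field K] [AddCommGroup H] [Module K H] (f : K[X]) (a : H) :
    polyDeriv K H (f ⊗ₜ[K] a) = derivative f ⊗ₜ[K] a := rfl

theorem polyDeriv_lieBr {K H : Type*} [Field K] [LieRing H] [LieAlgebra K H]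
    (y z : K[X] ⊗[K] H) : polyDeriv K H (lieBr K _ y z) =
      lieBr K _ (polyDeriv K H y) z + lieBr K _ y (polyDeriv K H z) := by
  induction y with
  | zero => simp
  | add y y' h h' => simp only [LinearMap.add_apply, map_add, h, h']; abel
  | tmul f a =>
    induction z with
    | zero => simp
    | add y y' h h' => simp only [map_add, h, h']; abel
    | tmul g b => simp only [lieBr_tmul, polyDeriv_tmul, derivative_mul, TensorProduct.add_tmul]

/-- The evaluation at `t` of polynomials with coefficients in `H`. -/
noncomputable def polyEval (K H : Type*) [Field K] [AddCommGroup H] [Module K H] (t : K) :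
    K[X] ⊗[K] H →ₗ[K] H :=
  (TensorProduct.lid K H).toLinearMap ∘ₗ (leval t).rTensor H

@[simp]
theorem polyEval_tmul {K H : Type*} [Field K] [AddCommGroup H] [Module K H] (t : K) (f : K[X])
    (a : H) : polyEval K H t (f ⊗ₜ[K] a) = f.eval t • a := by
  simp [polyEval]

theorem polyEval_lieBr {K H : Type*} [Field K] [LieRing H] [LieAlgebra K H] (t : K)
    (y z : K[X] ⊗[K] H) : polyEval K H t (lieBr K _ y z) =
      lieBr K H (polyEval K H t y) (polyEval K H t z) := by
  induction y with
  | zero => simp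
  | add y y' h h' => simp only [LinearMap.add_apply, map_add, h, h']
  | tmul f a =>
    induction z with
    | zero => simp
    | add y y' h h' => simp only [map_add, h, h']
    | tmul g b => simp [lieBr_tmul, smul_smul, mul_comm]

/-- In characteristic `p` a polynomial of degree less than `p` with derivative `0` is constant. -/
theorem polyEval_one_eq_polyEval_zero {K H : Type*} [Field K] [AddCommGroup H] [Module K H]
    (p : ℕ) [Fact p.Prime] [CharP K p] {z : K[X] ⊗[K] H} (hz : z ∈ polyLE K H (p - 1))
    (hd : polyDeriv K H z = 0) : polyEval K H 1 z = polyEval K H 0 z := by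
  have hp : 0 < p := (Fact.out : p.Prime).pos
  obtain ⟨w, rfl⟩ : ∃ w : ℕ → H, z = ∑ i ∈ Finset.range p, (X ^ i : K[X]) ⊗ₜ[K] w i := by
    clear hd
    induction hz using Submodule.span_induction with
    | mem z h =>
      obtain ⟨i, hi, a, rfl⟩ := h
      refine ⟨Pi.single i a, ?_⟩
      rw [Finset.sum_eq_single i]
      · simp
      · intro j _ hj; simp [hj]
      · intro h; exact absurd (Finset.mem_range.2 (by omega)) h
    | zero => exact ⟨0, by simp⟩
    | add _ _ _ _ h1 h2 =>
      obtain ⟨w, rfl⟩ := h1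
      obtain ⟨w', rfl⟩ := h2
      exact ⟨w + w', by simp [TensorProduct.tmul_add, Finset.sum_add_distrib]⟩
    | smul c _ _ h =>
      obtain ⟨w, rfl⟩ := h
      exact ⟨c • w, by simp [Finset.smul_sum]⟩
  -- The coefficient of X^i in the derivative is (i+1) w (i+1), and i+1 < p is invertible in K.
  have hw : ∀ i, i + 1 < p → w (i + 1) = 0 := by
    intro i hi
    have h0 : (((i + 1 : ℕ)) : K) ≠ 0 := by
      rw [Ne, CharP.cast_eq_zero_iff K p]
      exact fun h => absurd (Nat.le_of_dvd (by omega) h) (by omega)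
    have hc : ∀ j, TensorProduct.lid K H ((lcoeff K i).rTensor H
        (polyDeriv K H ((X ^ j : K[X]) ⊗ₜ[K] w j))) =
          (if j = i + 1 then ((j : ℕ) : K) else 0) • w j := by
      intro j
      rw [polyDeriv_tmul, LinearMap.rTensor_tmul, TensorProduct.lid_tmul, lcoeff_apply,
        derivative_X_pow, coeff_C_mul, coeff_X_pow]
      rcases j with _ | j
      · simp
      · congr 1
        by_cases hj : j = i
        · simp [hj]
        · rw [if_neg (fun h => hj (by omega)), if_neg (fun h => hj (by omega)), mul_zero]
    have h := congrArg (fun z => TensorProduct.lid K H ((lcoeff K i).rTensor H z)) hd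
    simp only [map_sum, map_zero, hc, ite_smul, zero_smul, Finset.sum_ite_eq',
      Finset.mem_range, hi, if_true] at h
    exact (smul_eq_zero.1 h).resolve_left h0
  simp only [map_sum, polyEval_tmul]
  refine Finset.sum_congr rfl fun i hi => ?_
  rcases i with _ | i
  · simp
  · rw [hw i (Finset.mem_range.1 hi), smul_zero, smul_zero]

/-- An n-fold bracket of linear polynomials has degree at most n + 1 in general. One degree is saved
at the first bracket, whose X²-coefficient is [b, a] = 0 or [a, a] = 0. For n = p - 1 this excludes
X^p, whose derivative would vanish. -/
theorem adCoeff_mem_polyLE {K H : Type*} [Field K] [LieRing H] [LieAlgebra K H] {a b a' b' : H}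
    (h : ⁅b, a⁆ = 0) {n : ℕ} (hn : 0 < n) (k : ℕ) :
    adCoeff (lieBr K (K[X] ⊗[K] H)) ((X : K[X]) ⊗ₜ[K] a + 1 ⊗ₜ a')
      ((X : K[X]) ⊗ₜ[K] b + 1 ⊗ₜ b') n k ∈ polyLE K H n := by
  have h0 : ∀ (i : ℕ) (a : H), i ≤ 1 → (X ^ i : K[X]) ⊗ₜ[K] a ∈ polyLE K H 1 :=
    fun i a hi => pow_tmul_mem_polyLE hi a
  have h1 : ∀ a a' : H, (X : K[X]) ⊗ₜ[K] a + 1 ⊗ₜ a' ∈ polyLE K H 1 := by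
    intro a a'
    have h1 := h0 1 a le_rfl
    have h2 := h0 0 a' zero_le_one
    rw [pow_one] at h1
    rw [pow_zero] at h2
    exact add_mem h1 h2
  have h2 : ∀ {a b a' b' : H}, ⁅b, a⁆ = 0 → lieBr K (K[X] ⊗[K] H) ((X : K[X]) ⊗ₜ[K] b + 1 ⊗ₜ b')
      ((X : K[X]) ⊗ₜ[K] a + 1 ⊗ₜ a') ∈ polyLE K H 1 := by
    intro a b a' b' h
    rw [← lieBr_apply (K := K)] at h
    simp only [map_add, LinearMap.add_apply, lieBr_tmul, h, one_mul, mul_one,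
      TensorProduct.tmul_zero, zero_add]
    have h3 := h0 1 (lieBr K H b' a) le_rfl
    have h4 := h0 1 (lieBr K H b a') le_rfl
    have h5 := h0 0 (lieBr K H b' a') zero_le_one
    rw [pow_one] at h3 h4
    rw [pow_zero] at h5
    exact add_mem h3 (add_mem h4 h5)
  induction n, hn using Nat.le_induction generalizing k with
  | base =>
    rcases k with _ | _ | k
    · exact h2 h
    · simpa [adCoeff] using h2 (lie_self a)
    · simp [adCoeff]
  | succ n _ ih =>
    have h3 := fun (a a' : H) k => add_comm 1 n ▸ lieBr_mem_polyLE (h1 a a') (ih k)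
    cases k with
    | zero => exact h3 _ _ _
    | succ k => exact add_mem (h3 _ _ _) (h3 _ _ _)

theorem jacobsonSum_mem_polyLE {K H : Type*} [Field K] [LieRing H] [LieAlgebra K H] {p : ℕ}
    (hp : 1 < p) {a b a' b' : H} (h : ⁅b, a⁆ = 0) :
    jacobsonSum p (lieBr K (K[X] ⊗[K] H)) ((X : K[X]) ⊗ₜ[K] a + 1 ⊗ₜ a')
      ((X : K[X]) ⊗ₜ[K] b + 1 ⊗ₜ b') ∈ polyLE K H (p - 1) :=
  Submodule.sum_mem _ fun _ _ => Submodule.smul_mem _ _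
    (adCoeff_mem_polyLE h (Nat.sub_pos_of_lt hp) _)

theorem lieBr_self {K H : Type*} [Field K] [LieRing H] [LieAlgebra K H] (a : H) :
    lieBr K H a a = 0 := lie_self a

theorem jacobsonSum_zero_left {K H : Type*} [Field K] [LieRing H] [LieAlgebra K H] {p : ℕ}
    (hp : 1 < p) (a : H) : jacobsonSum p (lieBr K H) 0 a = 0 :=
  jacobsonSum_eq_zero hp _ (by simp) (by simp)

theorem jacobsonSum_zero_right {K H : Type*} [Field K] [LieRing H] [LieAlgebra K H] {p : ℕ}
    (hp : 1 < p) (a : H) : jacobsonSum p (lieBr K H) a 0 = 0 :=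
  jacobsonSum_eq_zero hp _ (lieBr_self a) (by simp)

/-- The polynomial S(aX, b) - S(b, aX) has derivative 0, as both terms have the same coboundary for
derivative. It is thus constant; it vanishes at X = 0 and is the desired difference at X = 1. -/
theorem jacobsonSum_comm {K H : Type*} [Field K] [LieRing H] [LieAlgebra K H] (p : ℕ)
    [Fact p.Prime] [CharP K p] (a b : H) :
    jacobsonSum p (lieBr K H) a b = jacobsonSum p (lieBr K H) b a := by
  have hp : 1 < p := (Fact.out : p.Prime).one_lt
  set z := jacobsonSum p (lieBr K (K[X] ⊗[K] H)) ((X : K[X]) ⊗ₜ[K] a + 1 ⊗ₜ 0)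
    ((X : K[X]) ⊗ₜ[K] 0 + 1 ⊗ₜ b) - jacobsonSum p (lieBr K (K[X] ⊗[K] H))
    ((X : K[X]) ⊗ₜ[K] 0 + 1 ⊗ₜ b) ((X : K[X]) ⊗ₜ[K] a + 1 ⊗ₜ 0) with hz
  have hmem : z ∈ polyLE K H (p - 1) := Submodule.sub_mem _
    (jacobsonSum_mem_polyLE hp (by simp)) (jacobsonSum_mem_polyLE hp (by simp))
  have hd : polyDeriv K H z = 0 := by
    rw [hz, map_sub, derivation_jacobsonSum p (polyDeriv K H) polyDeriv_lieBr,
      derivation_jacobsonSum p (polyDeriv K H) polyDeriv_lieBr,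
      add_comm ((X : K[X]) ⊗ₜ[K] a + 1 ⊗ₜ 0)]
    abel
  have h := polyEval_one_eq_polyEval_zero p hmem hd
  rw [hz, map_sub, map_sub] at h
  simp only [map_jacobsonSum (polyEval K H _) (polyEval_lieBr _), map_add, polyEval_tmul, eval_X,
    eval_one, one_smul, zero_smul, smul_zero, add_zero, zero_add, jacobsonSum_zero_left hp,
    jacobsonSum_zero_right hp, sub_zero] at h
  exact sub_eq_zero.1 h

/-- The argument of `jacobsonSum_comm`, applied to the defect of the identity for aX, b, c: its
derivative is an alternating sum of coboundaries and cancels, and at X = 0 every remaining term has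
a zero argument or cancels. -/
theorem jacobsonSum_cocycle {K H : Type*} [Field K] [LieRing H] [LieAlgebra K H] (p : ℕ)
    [Fact p.Prime] [CharP K p] (a b c : H) :
    jacobsonSum p (lieBr K H) a b + jacobsonSum p (lieBr K H) (a + b) c =
      jacobsonSum p (lieBr K H) b c + jacobsonSum p (lieBr K H) a (b + c) := by
  have hp : 1 < p := (Fact.out : p.Prime).one_lt
  let l : H → H → K[X] ⊗[K] H := fun a a' => (X : K[X]) ⊗ₜ[K] a + 1 ⊗ₜ a'
  let S := jacobsonSum p (lieBr K (K[X] ⊗[K] H))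
  set z := S (l a 0) (l 0 b) + S (l a b) (l 0 c) - (S (l 0 b) (l 0 c) + S (l a 0) (l 0 (b + c)))
    with hz
  have hmem : z ∈ polyLE K H (p - 1) := by
    refine Submodule.sub_mem _ (add_mem ?_ ?_) (add_mem ?_ ?_) <;>
    exact jacobsonSum_mem_polyLE hp (by simp)
  have hadd : ∀ a a' b b', l a a' + l b b' = l (a + b) (a' + b') := by
    intro a a' b b'
    simp only [l, TensorProduct.tmul_add]
    abel
  have hd : polyDeriv K H z = 0 := by
    simp only [hz, S, map_sub, map_add, derivation_jacobsonSum p (polyDeriv K H) polyDeriv_lieBr,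
      hadd, add_zero, zero_add]
    abel
  have h := polyEval_one_eq_polyEval_zero p hmem hd
  simp only [hz, S, l, map_sub, map_add, map_jacobsonSum (polyEval K H _) (polyEval_lieBr _),
    polyEval_tmul, eval_X, eval_one, one_smul, zero_smul, smul_zero, add_zero, zero_add,
    jacobsonSum_zero_left hp, sub_self] at h
  exact sub_eq_zero.1 h

end Cocycle

/-! ### The even part of a Lie superalgebra -/

section EvenPart

theorem koszul_zero_left (K : Type*) [Field K] (i : ZMod 2) : koszul K 0 i = 1 := by
  simp [koszul]

theorem koszul_zero_right (K : Type*) [Field K] (i : ZMod 2) : koszul K i 0 = 1 := by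
  simp [koszul]

theorem koszul_one_one (K : Type*) [Field K] : koszul K 1 1 = -1 := by
  simp [koszul, ZMod.val_one]

variable {K L : Type*} [Field K] [AddCommGroup L] [Module K L] {A : ZMod 2 → Submodule K L}
  {br : L →ₗ[K] L →ₗ[K] L}

theorem IsLieSuperalgebra.even_skew (h : IsLieSuperalgebra A br) {a b : L} (ha : a ∈ A 0)
    (hb : b ∈ A 0) : br a b = -br b a := by
  simpa [koszul_zero_left] using h.skew 0 0 a ha b hb

theorem IsLieSuperalgebra.even_self (h : IsLieSuperalgebra A br) (h2 : (2 : K) ≠ 0) {a : L}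
    (ha : a ∈ A 0) : br a a = 0 := by
  have h1 := h.even_skew ha ha
  rw [eq_neg_iff_add_eq_zero, ← two_smul K] at h1
  exact (smul_eq_zero.1 h1).resolve_left h2

theorem IsLieSuperalgebra.even_jacobi (h : IsLieSuperalgebra A br) {a b : L} (ha : a ∈ A 0)
    (hb : b ∈ A 0) (c : L) : br a (br b c) = br (br a b) c + br b (br a c) := by
  simpa [koszul_zero_left] using h.jacobi 0 0 a ha b hb c

theorem IsLieSuperalgebra.even_br_mem (h : IsLieSuperalgebra A br) {a b : L} (ha : a ∈ A 0)
    (hb : b ∈ A 0) : br a b ∈ A 0 := by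
  simpa using h.graded 0 0 a ha b hb

/-- The even part of a Lie superalgebra is a Lie ring. -/
abbrev evenLieRing (h : IsLieSuperalgebra A br) (h2 : (2 : K) ≠ 0) : LieRing (A 0) where
  bracket a b := ⟨br a b, h.even_br_mem a.2 b.2⟩
  add_lie a b c := Subtype.ext (by simp)
  lie_add a b c := Subtype.ext (by simp)
  lie_self a := Subtype.ext (h.even_self h2 a.2)
  leibniz_lie a b c := Subtype.ext (h.even_jacobi a.2 b.2 c)

/-- The even part of a Lie superalgebra is a Lie algebra. -/
abbrev evenLieAlgebra (h : IsLieSuperalgebra A br) (h2 : (2 : K) ≠ 0) :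
    letI := evenLieRing h h2
    LieAlgebra K (A 0) :=
  letI := evenLieRing h h2
  { lie_smul := fun c a b => Subtype.ext (by simp [Bracket.bracket]) }

theorem two_ne_zero_of_char (K : Type*) [Field K] {p : ℕ} [CharP K p] (hp : 2 < p) :
    (2 : K) ≠ 0 := by
  have : ((2 : ℕ) : K) ≠ 0 := by
    rw [Ne, CharP.cast_eq_zero_iff K p]
    exact fun h => absurd (Nat.le_of_dvd two_pos h) (by omega)
  exact_mod_cast this

theorem IsLieSuperalgebra.coe_jacobsonSum (h : IsLieSuperalgebra A br) (h2 : (2 : K) ≠ 0) (p : ℕ)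
    (a b : A 0) : letI := evenLieRing h h2; letI := evenLieAlgebra h h2
    ((jacobsonSum p (lieBr K (A 0)) a b : A 0) : L) = jacobsonSum p br (a : L) (b : L) := by
  let _ := evenLieRing h h2
  let _ := evenLieAlgebra h h2
  exact map_jacobsonSum (A 0).subtype (fun _ _ => rfl) p a b

theorem IsLieSuperalgebra.jacobsonSum_mem (h : IsLieSuperalgebra A br) (h2 : (2 : K) ≠ 0) (p : ℕ)
    (a b : A 0) : jacobsonSum p br (a : L) (b : L) ∈ A 0 := by
  rw [← h.coe_jacobsonSum h2]
  exact Subtype.coe_prop _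

theorem IsLieSuperalgebra.jacobsonSum_comm (h : IsLieSuperalgebra A br) (h2 : (2 : K) ≠ 0) (p : ℕ)
    [Fact p.Prime] [CharP K p] (a b : A 0) :
    jacobsonSum p br (a : L) b = jacobsonSum p br (b : L) a := by
  let _ := evenLieRing h h2
  let _ := evenLieAlgebra h h2
  rw [← h.coe_jacobsonSum h2, ← h.coe_jacobsonSum h2, _root_.jacobsonSum_comm]

theorem IsLieSuperalgebra.jacobsonSum_cocycle (h : IsLieSuperalgebra A br) (h2 : (2 : K) ≠ 0)
    (p : ℕ) [Fact p.Prime] [CharP K p] (a b c : A 0) :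
    jacobsonSum p br (a : L) b + jacobsonSum p br ((a : L) + b) c =
      jacobsonSum p br (b : L) c + jacobsonSum p br (a : L) (b + c) := by
  let _ := evenLieRing h h2
  let _ := evenLieAlgebra h h2
  have h1 := congrArg (A 0).subtype (_root_.jacobsonSum_cocycle (K := K) p a b c)
  simp only [map_add, Submodule.subtype_apply, h.coe_jacobsonSum h2] at h1
  exact h1

theorem IsLieSuperalgebra.jacobsonSum_smul_self (h : IsLieSuperalgebra A br) (h2 : (2 : K) ≠ 0)
    {p : ℕ} (hp : 1 < p) (c d : K) {a : L} (ha : a ∈ A 0) :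
    jacobsonSum p br (c • a) (d • a) = 0 :=
  jacobsonSum_eq_zero hp _ (by simp [h.even_self h2 ha]) (by simp [h.even_self h2 ha])

/-- The even part acts on all of L by the bracket, so this is Jacobson's formula in `Module.End K
L`. It reduces the condition on ad to the summands of an even element. -/
theorem IsLieSuperalgebra.br_jacobsonSum (h : IsLieSuperalgebra A br) (h2 : (2 : K) ≠ 0) (p : ℕ)
    [Fact p.Prime] [CharP K p] (a b : A 0) (y : L) :
    br (jacobsonSum p br (a : L) b) y =
      (br ((a : L) + b))^[p] y - (br (a : L))^[p] y - (br (b : L))^[p] y := by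
  let _ := evenLieRing h h2
  let _ := evenLieAlgebra h h2
  have h1 := LinearMap.congr_fun (map_jacobsonSum_eq_sub (E := Module.End K L) p
    (br := lieBr K (A 0)) (br ∘ₗ (A 0).subtype) (fun u v => LinearMap.ext fun z =>
      eq_sub_of_add_eq (h.even_jacobi u.2 v.2 z).symm) a b) y
  simpa only [LinearMap.comp_apply, Submodule.subtype_apply, h.coe_jacobsonSum h2,
    LinearMap.sub_apply, Module.End.pow_apply, Submodule.coe_add] using h1

end EvenPart

/-! ### Splitting of p-homogeneous cocycles -/

section Splitting

/-- The extension of `V` by `K` defined by a cocycle. -/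
@[ext]
structure CocycleExtension {K V : Type*} (F : V → V → K) where
  /-- The component in `K`. -/
  fst : K
  /-- The component in `V`. -/
  snd : V

/-- A `p`-homogeneous symmetric cocycle that is trivial on lines is a coboundary. -/
theorem exists_homogeneous_of_cocycle {K V : Type*} [Field K] [AddCommGroup V] [Module K V]
    (p : ℕ) [Fact p.Prime] [CharP K p] (F : V → V → K) (comm : ∀ a b, F a b = F b a)
    (cocycle : ∀ a b c, F a b + F (a + b) c = F b c + F a (b + c))
    (smul : ∀ (c : K) a b, F (c • a) (c • b) = c ^ p * F a b)
    (self : ∀ (c d : K) a, F (c • a) (d • a) = 0) :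
    ∃ P : V → K, (∀ (c : K) a, P (c • a) = c ^ p * P a) ∧
      ∀ a b, P (a + b) = P a + P b + F a b := by
  have hp : p ≠ 0 := (Fact.out : p.Prime).ne_zero
  have hz : ∀ a, F 0 a = 0 := fun a => by
    have h1 := cocycle 0 0 a
    have h2 := self 0 0 a
    simp only [zero_smul, add_zero, zero_add] at h1 h2
    rw [h2, zero_add] at h1
    exact left_eq_add.1 h1
  have hneg : ∀ a, F (-a) a = 0 := fun a => by simpa using self (-1) 1 a
  -- Addition is twisted by F: associativity is the cocycle identity, commutativity is the symmetry
  -- of F, and F (-a) a = 0 makes the componentwise negative an inverse.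
  let _ : Add (CocycleExtension F) := ⟨fun u v => ⟨u.fst + v.fst + F u.snd v.snd, u.snd + v.snd⟩⟩
  let _ : Zero (CocycleExtension F) := ⟨⟨0, 0⟩⟩
  let _ : Neg (CocycleExtension F) := ⟨fun u => ⟨-u.fst, -u.snd⟩⟩
  let _ : AddCommGroup (CocycleExtension F) :=
    { add_assoc := fun u v w => CocycleExtension.ext
        (show u.fst + v.fst + F u.snd v.snd + w.fst + F (u.snd + v.snd) w.snd =
          u.fst + (v.fst + w.fst + F v.snd w.snd) + F u.snd (v.snd + w.snd) by
          linear_combination cocycle u.snd v.snd w.snd) (add_assoc _ _ _)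
      zero_add := fun u => CocycleExtension.ext
        (show 0 + u.fst + F 0 u.snd = u.fst by rw [hz]; ring) (zero_add _)
      add_zero := fun u => CocycleExtension.ext
        (show u.fst + 0 + F u.snd 0 = u.fst by rw [comm, hz]; ring) (add_zero _)
      add_comm := fun u v => CocycleExtension.ext
        (show u.fst + v.fst + F u.snd v.snd = v.fst + u.fst + F v.snd u.snd by
          rw [comm]; ring) (add_comm _ _)
      neg_add_cancel := fun u => CocycleExtension.ext
        (show -u.fst + u.fst + F (-u.snd) u.snd = 0 by rw [hneg]; ring) (neg_add_cancel _)
      nsmul := nsmulRec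
      zsmul := zsmulRec }
  -- Scalars act on the component in K through the Frobenius c ↦ c^p. Distributivity over vectors is
  -- the homogeneity of F; distributivity over scalars needs F to vanish on lines.
  let _ : Module K (CocycleExtension F) :=
    { smul := fun c u => ⟨c ^ p * u.fst, c • u.snd⟩
      one_smul := fun u => CocycleExtension.ext
        (show 1 ^ p * u.fst = u.fst by rw [one_pow, one_mul]) (one_smul _ _)
      mul_smul := fun c d u => CocycleExtension.ext
        (show (c * d) ^ p * u.fst = c ^ p * (d ^ p * u.fst) by ring) (mul_smul _ _ _)
      smul_zero := fun c => CocycleExtension.ext (mul_zero _) (smul_zero _)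
      zero_smul := fun u => CocycleExtension.ext
        (show 0 ^ p * u.fst = 0 by rw [zero_pow hp, zero_mul]) (zero_smul _ _)
      smul_add := fun c u v => CocycleExtension.ext
        (show c ^ p * (u.fst + v.fst + F u.snd v.snd) =
          c ^ p * u.fst + c ^ p * v.fst + F (c • u.snd) (c • v.snd) by rw [smul]; ring)
        (smul_add _ _ _)
      add_smul := fun c d u => CocycleExtension.ext
        (show (c + d) ^ p * u.fst = c ^ p * u.fst + d ^ p * u.fst + F (c • u.snd) (d • u.snd) by
          rw [self, add_pow_char]; ring) (add_smul _ _ _) }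
  let π : CocycleExtension F →ₗ[K] V :=
    { toFun := CocycleExtension.snd
      map_add' := fun _ _ => rfl
      map_smul' := fun _ _ => rfl }
  -- A surjection of vector spaces has a linear section. Linearity of s for the twisted structure
  -- amounts, in the component in K, to the two conditions on P.
  obtain ⟨s, hs⟩ := π.exists_rightInverse_of_surjective
    (LinearMap.range_eq_top.2 fun a => ⟨⟨0, a⟩, rfl⟩)
  have hs' : ∀ a, (s a).snd = a := fun a => LinearMap.congr_fun hs a
  refine ⟨fun a => (s a).fst, fun c a => congrArg CocycleExtension.fst (map_smul s c a),
    fun a b => ?_⟩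
  have h := congrArg CocycleExtension.fst (map_add s a b)
  have h2 : (s a + s b).fst = (s a).fst + (s b).fst + F (s a).snd (s b).snd := rfl
  rw [h2, hs', hs'] at h
  exact h

end Splitting

/-! ### Odd invariant forms and parity signs -/

section Forms

variable {K L : Type*} [Field K] [AddCommGroup L] [Module K L] {A : ZMod 2 → Submodule K L}
  {br : L →ₗ[K] L →ₗ[K] L} {B : L →ₗ[K] L →ₗ[K] K} {D : L →ₗ[K] L}

theorem zmod_two_eq_zero_or_one (i : ZMod 2) : i = 0 ∨ i = 1 := by
  revert i; decide

theorem isInternal_iff_isCompl_zmod_two (A : ZMod 2 → Submodule K L) :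
    DirectSum.IsInternal A ↔ IsCompl (A 0) (A 1) :=
  DirectSum.isInternal_submodule_iff_isCompl A (by decide)
    (Set.ext fun i => by simpa using zmod_two_eq_zero_or_one i)

theorem exists_eq_add_of_isInternal (h : DirectSum.IsInternal A) (a : L) :
    ∃ a₀ ∈ A 0, ∃ a₁ ∈ A 1, a = a₀ + a₁ := by
  have h1 := ((isInternal_iff_isCompl_zmod_two A).1 h).sup_eq_top
  obtain ⟨a₀, h₀, a₁, h₁, rfl⟩ := Submodule.mem_sup.1 (h1 ▸ Submodule.mem_top : a ∈ A 0 ⊔ A 1)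
  exact ⟨a₀, h₀, a₁, h₁, rfl⟩

theorem IsNIS.eq_zero (hB : IsNIS A br B 1) {i j : ZMod 2} (hij : i = j) {a b : L}
    (ha : a ∈ A i) (hb : b ∈ A j) : B a b = 0 := by
  refine hB.parity i j a ha b hb ?_
  subst hij
  rcases zmod_two_eq_zero_or_one i with rfl | rfl <;> decide

/-- The sign is -1 only for two odd arguments, and there an odd form vanishes. -/
theorem IsNIS.comm (hB : IsNIS A br B 1) (hA : DirectSum.IsInternal A) (a b : L) :
    B a b = B b a := by
  have h : ∀ i j : ZMod 2, ∀ a ∈ A i, ∀ b ∈ A j, B a b = B b a := by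
    intro i j a ha b hb
    rw [hB.symm i j a ha b hb]
    rcases zmod_two_eq_zero_or_one i with rfl | rfl
    · rw [koszul_zero_left, one_mul]
    · rcases zmod_two_eq_zero_or_one j with rfl | rfl
      · rw [koszul_zero_right, one_mul]
      · rw [hB.eq_zero rfl ha hb, mul_zero]
  obtain ⟨a₀, h₀, a₁, h₁, rfl⟩ := exists_eq_add_of_isInternal hA a
  obtain ⟨b₀, h₂, b₁, h₃, rfl⟩ := exists_eq_add_of_isInternal hA b
  simp only [map_add, LinearMap.add_apply, h 0 0 a₀ h₀ b₀ h₂, h 0 1 a₀ h₀ b₁ h₃,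
    h 1 0 a₁ h₁ b₀ h₂, h 1 1 a₁ h₁ b₁ h₃]
  ring

theorem IsDInvariant.even_apply (hD : IsDInvariant A B 0 D) (hA : DirectSum.IsInternal A)
    (a b : L) : B (D a) b = -B a (D b) := by
  obtain ⟨a₀, h₀, a₁, h₁, rfl⟩ := exists_eq_add_of_isInternal hA a
  have h2 := hD 0 a₀ h₀ b
  have h3 := hD 1 a₁ h₁ b
  rw [koszul_zero_left] at h2 h3
  simp only [map_add, LinearMap.add_apply]
  linear_combination h2 + h3

theorem parityOp_zero (hA : DirectSum.IsInternal A) (a : L) : parityOp hA 0 a = a := by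
  obtain ⟨a₀, h₀, a₁, h₁, rfl⟩ := exists_eq_add_of_isInternal hA a
  rw [map_add, parityOp_apply hA 0 0 a₀ h₀, parityOp_apply hA 0 1 a₁ h₁, koszul_zero_left,
    koszul_zero_left, one_smul, one_smul]

theorem parityOp_of_mem_zero (hA : DirectSum.IsInternal A) (d : ZMod 2) {a : L} (ha : a ∈ A 0) :
    parityOp hA d a = a := by
  rw [parityOp_apply hA d 0 a ha, koszul_zero_right, one_smul]

theorem parityOp_one_of_mem_one (hA : DirectSum.IsInternal A) {a : L} (ha : a ∈ A 1) :
    parityOp hA 1 a = -a := by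
  rw [parityOp_apply hA 1 1 a ha, koszul_one_one, neg_one_smul]

theorem IsDInvariant.odd_apply (hD : IsDInvariant A B 1 D) (hA : DirectSum.IsInternal A)
    (a b : L) : B (D (parityOp hA 1 a)) b = -B a (D b) := by
  obtain ⟨a₀, h₀, a₁, h₁, rfl⟩ := exists_eq_add_of_isInternal hA a
  have h2 := hD 0 a₀ h₀ b
  have h3 := hD 1 a₁ h₁ b
  rw [koszul_zero_right] at h2
  rw [koszul_one_one] at h3
  simp only [map_add, LinearMap.add_apply, parityOp_of_mem_zero hA 1 h₀,
    parityOp_one_of_mem_one hA h₁, map_neg, LinearMap.neg_apply]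
  linear_combination h2 - h3

end Forms

/-! ### Grading and form of the double extension; the bracket for an even derivation -/

namespace DoubleExt

variable {K L : Type*} [Field K] [AddCommGroup L] [Module K L] {A : ZMod 2 → Submodule K L}
  {br : L →ₗ[K] L →ₗ[K] L} {B : L →ₗ[K] L →ₗ[K] K} {D : L →ₗ[K] L}

theorem mem_grading {d i : ZMod 2} {g : K × L × K} : g ∈ grading A d i ↔
    (i ≠ d + 1 → g.1 = 0) ∧ g.2.1 ∈ A i ∧ (i ≠ d → g.2.2 = 0) := by
  rw [grading, Submodule.mem_prod, Submodule.mem_prod]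
  refine and_congr ?_ (and_congr Iff.rfl ?_) <;> split_ifs with h <;> simp [h]

theorem isInternal_grading (hA : DirectSum.IsInternal A) (d : ZMod 2) :
    DirectSum.IsInternal (grading A d) := by
  have h := (isInternal_iff_isCompl_zmod_two A).1 hA
  have key : ∀ i j : ZMod 2, i ≠ j → (i ≠ d + 1 ↔ j = d + 1) ∧ (i ≠ d ↔ j = d) := by
    revert d; decide
  obtain ⟨k1, k2⟩ := key 0 1 (by decide)
  rw [isInternal_iff_isCompl_zmod_two]
  constructor
  · rw [Submodule.disjoint_def]
    intro g h0 h1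
    rw [mem_grading] at h0 h1
    refine Prod.ext ?_ (Prod.ext ?_ ?_)
    · by_cases hd : (1 : ZMod 2) = d + 1
      · exact h0.1 (k1.2 hd)
      · exact h1.1 hd
    · exact Submodule.disjoint_def.1 h.disjoint _ h0.2.1 h1.2.1
    · by_cases hd : (1 : ZMod 2) = d
      · exact h0.2.2 (k2.2 hd)
      · exact h1.2.2 hd
  · rw [codisjoint_iff, eq_top_iff]
    rintro ⟨s, a, t⟩ -
    obtain ⟨a₀, h₀, a₁, h₁, rfl⟩ := exists_eq_add_of_isInternal hA a
    refine Submodule.mem_sup.2 ⟨(if (0 : ZMod 2) = d + 1 then s else 0, a₀,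
      if (0 : ZMod 2) = d then t else 0), mem_grading.2 ⟨fun h => if_neg h, h₀, fun h => if_neg h⟩,
      (if (1 : ZMod 2) = d + 1 then s else 0, a₁, if (1 : ZMod 2) = d then t else 0),
      mem_grading.2 ⟨fun h => if_neg h, h₁, fun h => if_neg h⟩, ?_⟩
    refine Prod.ext ?_ (Prod.ext rfl ?_)
    · change (if (0 : ZMod 2) = d + 1 then s else 0) + (if (1 : ZMod 2) = d + 1 then s else 0) = s
      by_cases hd : (1 : ZMod 2) = d + 1
      · rw [if_neg (k1.2 hd), if_pos hd, zero_add]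
      · rw [if_pos (not_not.1 (mt k1.1 hd)), if_neg hd, add_zero]
    · change (if (0 : ZMod 2) = d then t else 0) + (if (1 : ZMod 2) = d then t else 0) = t
      by_cases hd : (1 : ZMod 2) = d
      · rw [if_neg (k2.2 hd), if_pos hd, zero_add]
      · rw [if_pos (not_not.1 (mt k2.1 hd)), if_neg hd, add_zero]

theorem form_apply (g h : K × L × K) :
    form B g h = B g.2.1 h.2.1 + g.1 * h.2.2 + g.2.2 * h.1 := rfl

/-- Everything except invariance is independent of the bracket: x and x* have opposite parities, so
pairing them keeps the form odd, and an odd supersymmetric form is symmetric. -/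
theorem isNIS_form (hA : DirectSum.IsInternal A) (hB : IsNIS A br B 1) (d : ZMod 2)
    {brg : (K × L × K) →ₗ[K] (K × L × K) →ₗ[K] (K × L × K)}
    (hinv : ∀ a b c, form B (brg a b) c = form B a (brg b c)) :
    IsNIS (grading A d) brg (form B) 1 := by
  have hpar : ∀ i j : ZMod 2, ∀ a ∈ grading A d i, ∀ b ∈ grading A d j, i + j ≠ 1 →
      form B a b = 0 := by
    intro i j g hg h hh hij
    rw [mem_grading] at hg hh
    have key : ∀ d i j : ZMod 2, i + j ≠ 1 → (i ≠ d + 1 ∨ j ≠ d) ∧ (i ≠ d ∨ j ≠ d + 1) := by decide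
    obtain ⟨k1, k2⟩ := key d i j hij
    have e1 : g.1 * h.2.2 = 0 := by
      rcases k1 with k | k
      · rw [hg.1 k, zero_mul]
      · rw [hh.2.2 k, mul_zero]
    have e2 : g.2.2 * h.1 = 0 := by
      rcases k2 with k | k
      · rw [hg.2.2 k, zero_mul]
      · rw [hh.1 k, mul_zero]
    rw [form_apply, hB.parity i j _ hg.2.1 _ hh.2.1 hij, e1, e2, add_zero, add_zero]
  have hsymm : ∀ a b, form B b a = form B a b := by
    intro a b
    rw [form_apply, form_apply, hB.comm hA]
    ring
  refine ⟨hpar, fun i j a ha b hb => ?_, hinv, ?_⟩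
  · rw [hsymm]
    rcases zmod_two_eq_zero_or_one i with rfl | rfl
    · rw [koszul_zero_left, one_mul]
    · rcases zmod_two_eq_zero_or_one j with rfl | rfl
      · rw [koszul_zero_right, one_mul]
      · rw [hpar 1 1 a ha b hb (by decide), mul_zero]
  · have hsep : ∀ g, (∀ h, form B g h = 0) → g = 0 := by
      intro g hg
      refine Prod.ext ?_ (Prod.ext ?_ ?_)
      · simpa [form_apply] using hg (0, 0, 1)
      · exact hB.nondegenerate.1 _ fun b => by simpa [form_apply] using hg (0, b, 0)
      · simpa [form_apply] using hg (1, 0, 0)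
    exact ⟨hsep, fun g hg => hsep g fun h => by rw [hsymm]; exact hg h⟩

theorem evenBracket_apply (hA : DirectSum.IsInternal A) (g h : K × L × K) :
    evenBracket hA br B D g h = (B (D g.2.1) h.2.1,
      br g.2.1 h.2.1 + g.2.2 • D h.2.1 - h.2.2 • D g.2.1, 0) := by
  refine Prod.ext ?_ (Prod.ext ?_ rfl) <;> simp [evenBracket, bracket, parityOp_zero]

/-- The x-component of [a, b] is its pairing with x*, and B(D a, b) is the value that invariance
dictates, since [x*, a] = D a. -/
theorem evenBracket_invariant (hA : DirectSum.IsInternal A) (hB : IsNIS A br B 1)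
    (hD : IsDInvariant A B 0 D) (a b c : K × L × K) :
    form B (evenBracket hA br B D a b) c = form B a (evenBracket hA br B D b c) := by
  simp only [form_apply, evenBracket_apply, map_add, map_sub, map_smul, LinearMap.add_apply,
    LinearMap.sub_apply, LinearMap.smul_apply, smul_eq_mul, hD.even_apply hA, hB.invariant]
  ring

/-- The double extension by an even derivation is a Lie superalgebra. -/
theorem isLieSuperalgebra_even (h : IsLieSuperalgebra A br) (hB : IsNIS A br B 1)
    (hgr : ∀ i : ZMod 2, ∀ a ∈ A i, D a ∈ A i)
    (hleib : ∀ a b : L, D (br a b) = br (D a) b + br a (D b)) (hD : IsDInvariant A B 0 D)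
    (hcube : ∀ a ∈ A 1, B (D a) (br a a) = 0) :
    IsLieSuperalgebra (grading A 0) (evenBracket h.internal br B D) := by
  have hA := h.internal
  refine ⟨isInternal_grading hA 0, ?_, ?_, ?_, ?_⟩
  · rintro i j ⟨s, a, t⟩ hg ⟨s', a', t'⟩ hg'
    rw [mem_grading] at hg hg' ⊢
    obtain ⟨hg1, hg2, hg3⟩ := hg
    obtain ⟨hg1', hg2', hg3'⟩ := hg'
    dsimp only at hg1 hg2 hg3 hg1' hg2' hg3'
    rw [evenBracket_apply]
    refine ⟨fun hij => hB.parity i j _ (hgr i _ hg2) _ hg2' (by simpa using hij), ?_, fun _ => rfl⟩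
    refine sub_mem (add_mem (h.graded i j a hg2 a' hg2') ?_) ?_
    · rcases zmod_two_eq_zero_or_one i with rfl | rfl
      · rw [zero_add]; exact Submodule.smul_mem _ _ (hgr j _ hg2')
      · simp [hg3 (by decide)]
    · rcases zmod_two_eq_zero_or_one j with rfl | rfl
      · rw [add_zero]; exact Submodule.smul_mem _ _ (hgr i _ hg2)
      · simp [hg3' (by decide)]
  · rintro i j ⟨s, a, t⟩ hg ⟨s', a', t'⟩ hg'
    obtain ⟨hg1, hg2, hg3⟩ := mem_grading.1 hg
    obtain ⟨hg1', hg2', hg3'⟩ := mem_grading.1 hg'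
    dsimp only at hg1 hg2 hg3 hg1' hg2' hg3'
    have hs := h.skew i j a hg2 a' hg2'
    have hinv := hD.even_apply hA a a'
    have hc := hB.comm hA a (D a')
    have hz : i = j → B (D a') a = 0 := fun hij => hB.eq_zero hij.symm (hgr j _ hg2') hg2
    rw [evenBracket_apply, evenBracket_apply]
    refine Prod.ext ?_ (Prod.ext ?_ (by simp))
    · simp only [Prod.fst_neg, Prod.smul_fst, smul_eq_mul]
      rcases zmod_two_eq_zero_or_one i with rfl | rfl
      · rw [koszul_zero_left]; linear_combination hinv - hc
      · rcases zmod_two_eq_zero_or_one j with rfl | rfl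
        · rw [koszul_zero_right]; linear_combination hinv - hc
        · linear_combination hinv - hc + (koszul K 1 1 - 1) * hz rfl
    · simp only [Prod.snd_neg, Prod.smul_snd, Prod.fst_neg, Prod.smul_fst, hs]
      rcases zmod_two_eq_zero_or_one i with rfl | rfl
      · rw [koszul_zero_left]; module
      · rcases zmod_two_eq_zero_or_one j with rfl | rfl
        · rw [koszul_zero_right]; module
        · rw [hg3 (by decide), hg3' (by decide)]; module
  · rintro i j ⟨s, a, t⟩ hg ⟨s', b, t'⟩ hg' ⟨s'', c, t''⟩
    obtain ⟨hg1, hg2, hg3⟩ := mem_grading.1 hg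
    obtain ⟨hg1', hg2', hg3'⟩ := mem_grading.1 hg'
    dsimp only at hg1 hg2 hg3 hg1' hg2' hg3'
    have hj := h.jacobi i j a hg2 b hg2' c
    have hs := h.skew i j a hg2 (D b) (hgr j _ hg2')
    have hs' := h.skew i j (D a) (hgr i _ hg2) b hg2'
    have hz : i = j → B (D a) (D b) = 0 := fun hij =>
      hB.eq_zero hij (hgr i _ hg2) (hgr j _ hg2')
    have hx : ∀ y, B (br a (D b)) y = -(koszul K i j * B (D b) (br a y)) := by
      intro y
      rw [hs, map_neg, LinearMap.neg_apply, map_smul, LinearMap.smul_apply, hB.invariant,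
        smul_eq_mul]
    have hy : B (D (D a)) c = -B (D a) (D c) := hD.even_apply hA _ _
    have hy' : B (D (D b)) c = -B (D b) (D c) := hD.even_apply hA _ _
    have hc := hB.comm hA (D a) (D b)
    simp only [evenBracket_apply]
    refine Prod.ext ?_ (Prod.ext ?_ (by simp))
    -- The x-component says that B(D a, b) is a 2-cocycle. When both elements are odd their
    -- x*-components are 0, as x* is even.
    · simp only [Prod.fst_add, Prod.smul_fst, smul_eq_mul, map_add, map_sub, map_smul,
        LinearMap.add_apply, LinearMap.sub_apply, LinearMap.smul_apply, hleib, hx, hy, hy',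
        hB.invariant]
      rcases zmod_two_eq_zero_or_one i with rfl | rfl
      · rw [koszul_zero_left]; linear_combination -t'' * hc
      · rcases zmod_two_eq_zero_or_one j with rfl | rfl
        · rw [koszul_zero_right]; linear_combination -t'' * hc
        · rw [hg3 (by decide), hg3' (by decide), ← hc, hz rfl]; ring
    · simp only [Prod.snd_add, Prod.smul_snd, Prod.fst_add, Prod.smul_fst, map_add, map_sub,
        map_smul, LinearMap.add_apply, LinearMap.sub_apply, LinearMap.smul_apply, hleib, hj, hs']
      rcases zmod_two_eq_zero_or_one i with rfl | rfl
      · rw [koszul_zero_left]; module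
      · rcases zmod_two_eq_zero_or_one j with rfl | rfl
        · rw [koszul_zero_right]; module
        · rw [hg3 (by decide), hg3' (by decide), koszul_one_one]; module
  · rintro ⟨s, a, t⟩ hg
    obtain ⟨hg1, hg2, hg3⟩ := mem_grading.1 hg
    dsimp only at hg1 hg2 hg3
    simp [evenBracket_apply, hg3, hcube a hg2, h.odd_cube a hg2]

end DoubleExt

/-! ### The bracket for an odd derivation -/

namespace DoubleExt

variable {K L : Type*} [Field K] [AddCommGroup L] [Module K L] {A : ZMod 2 → Submodule K L}
  {br : L →ₗ[K] L →ₗ[K] L} {B : L →ₗ[K] L →ₗ[K] K} {D : L →ₗ[K] L}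

/-- Both sides vanish for even a, as B is odd. Hence the x-component of [x*, a] is simply 2 B(a,
b₀). -/
theorem form_parityOp (hA : DirectSum.IsInternal A) (hB : IsNIS A br B 1) {b₀ : L}
    (hb : b₀ ∈ A 0) (a : L) : B (parityOp hA 1 a) b₀ = -B a b₀ := by
  obtain ⟨c, h₀, c', h₁, rfl⟩ := exists_eq_add_of_isInternal hA a
  simp [parityOp_of_mem_zero hA 1 h₀, parityOp_one_of_mem_one hA h₁, hB.eq_zero rfl h₀ hb]

theorem oddBracket_apply (hA : DirectSum.IsInternal A) (hB : IsNIS A br B 1) {b₀ : L}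
    (hb : b₀ ∈ A 0) (l : K) (g h : K × L × K) :
    oddBracket hA br B D b₀ l g h =
      (B (D g.2.1) h.2.1 + 2 * g.2.2 * B h.2.1 b₀ + 2 * h.2.2 * B g.2.1 b₀ + g.2.2 * h.2.2 * l,
        br g.2.1 h.2.1 + g.2.2 • D h.2.1 - h.2.2 • D (parityOp hA 1 g.2.1) +
          (g.2.2 * h.2.2) • (2 : K) • b₀, 0) := by
  refine Prod.ext ?_ rfl
  simp [oddBracket, bracket, form_parityOp hA hB hb]
  ring

/-- Pairing [x*, x*] with a shows where the term 2 B(a, b₀) x in [x*, a] comes from. -/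
theorem oddBracket_invariant (hA : DirectSum.IsInternal A) (hB : IsNIS A br B 1)
    (hD : IsDInvariant A B 1 D) {b₀ : L} (hb : b₀ ∈ A 0) (l : K) (a b c : K × L × K) :
    form B (oddBracket hA br B D b₀ l a b) c = form B a (oddBracket hA br B D b₀ l b c) := by
  have h2 := hD.odd_apply hA b.2.1 a.2.1
  have h3 := hB.comm hA (D (parityOp hA 1 b.2.1)) a.2.1
  have h4 := hB.comm hA b.2.1 (D a.2.1)
  have h5 := hB.comm hA b₀ c.2.1
  simp only [form_apply, oddBracket_apply hA hB hb, map_add, map_sub, map_smul,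
    LinearMap.add_apply, LinearMap.sub_apply, LinearMap.smul_apply, smul_eq_mul, hD.odd_apply hA,
    hB.invariant]
  linear_combination c.2.2 * (h2 - h3 - h4) + 2 * a.2.2 * b.2.2 * h5

/-- The hypotheses on an odd derivation that make the double extension a Lie superalgebra. -/
structure OddData (A : ZMod 2 → Submodule K L) (br : L →ₗ[K] L →ₗ[K] L) (B : L →ₗ[K] L →ₗ[K] K)
    (D : L →ₗ[K] L) (b₀ : L) : Prop where
  lie : IsLieSuperalgebra A br
  nis : IsNIS A br B 1
  graded : ∀ i : ZMod 2, ∀ a ∈ A i, D a ∈ A (i + 1)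
  leibniz : ∀ i : ZMod 2, ∀ a ∈ A i, ∀ b : L, D (br a b) = br (D a) b + koszul K 1 i • br a (D b)
  dinv : IsDInvariant A B 1 D
  mem : b₀ ∈ A 0
  sq : ∀ a, D (D a) = br b₀ a
  map : D b₀ = 0

namespace OddData

variable {b₀ : L}

theorem form_D_base (H : OddData A br B D b₀) (a : L) : B (D a) b₀ = 0 := by
  obtain ⟨c, h₀, c', h₁, rfl⟩ := exists_eq_add_of_isInternal H.lie.internal a
  have h2 := H.dinv 0 c h₀ b₀
  have h3 := H.dinv 1 c' h₁ b₀
  rw [H.map, map_zero, mul_zero, add_zero] at h2 h3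
  rw [map_add, map_add, LinearMap.add_apply, h2, h3, add_zero]

theorem br_base (H : OddData A br B D b₀) (a : L) : br a b₀ = -br b₀ a := by
  obtain ⟨c, h₀, c', h₁, rfl⟩ := exists_eq_add_of_isInternal H.lie.internal a
  have h2 := H.lie.skew 0 0 c h₀ b₀ H.mem
  have h3 := H.lie.skew 1 0 c' h₁ b₀ H.mem
  rw [koszul_zero_right, one_smul] at h2 h3
  rw [map_add, map_add, LinearMap.add_apply, h2, h3]
  abel

theorem D_mem_one (H : OddData A br B D b₀) {a : L} (ha : a ∈ A 0) : D a ∈ A 1 := by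
  simpa using H.graded 0 a ha

theorem D_mem_zero (H : OddData A br B D b₀) {a : L} (ha : a ∈ A 1) : D a ∈ A 0 :=
  H.graded 1 a ha

theorem leibniz_zero (H : OddData A br B D b₀) {a : L} (ha : a ∈ A 0) (b : L) :
    D (br a b) = br (D a) b + br a (D b) := by
  rw [H.leibniz 0 a ha, koszul_zero_right, one_smul]

theorem leibniz_one (H : OddData A br B D b₀) {a : L} (ha : a ∈ A 1) (b : L) :
    D (br a b) = br (D a) b - br a (D b) := by
  rw [H.leibniz 1 a ha, koszul_one_one, neg_one_smul, sub_eq_add_neg]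

theorem dinv_zero (H : OddData A br B D b₀) {a : L} (ha : a ∈ A 0) (b : L) :
    B (D a) b = -B a (D b) := by
  have h := H.dinv 0 a ha b
  rw [koszul_zero_right] at h
  linear_combination h

theorem dinv_one (H : OddData A br B D b₀) {a : L} (ha : a ∈ A 1) (b : L) :
    B (D a) b = B a (D b) := by
  have h := H.dinv 1 a ha b
  rw [koszul_one_one] at h
  linear_combination h

theorem br_swap_zero_left (H : OddData A br B D b₀) {i : ZMod 2} {a b : L} (ha : a ∈ A 0)
    (hb : b ∈ A i) : br a b = -br b a := by
  rw [H.lie.skew 0 i a ha b hb, koszul_zero_left, one_smul]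

theorem br_swap_zero_right (H : OddData A br B D b₀) {i : ZMod 2} {a b : L} (ha : a ∈ A i)
    (hb : b ∈ A 0) : br a b = -br b a := by
  rw [H.lie.skew i 0 a ha b hb, koszul_zero_right, one_smul]

theorem br_swap_one_one (H : OddData A br B D b₀) {a b : L} (ha : a ∈ A 1)
    (hb : b ∈ A 1) : br a b = br b a := by
  rw [H.lie.skew 1 1 a ha b hb, koszul_one_one, neg_one_smul, neg_neg]

theorem jacobi_even (H : OddData A br B D b₀) {i j : ZMod 2} (hij : i = 0 ∨ j = 0) {a b : L}
    (ha : a ∈ A i) (hb : b ∈ A j) (c : L) :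
    br a (br b c) = br (br a b) c + br b (br a c) := by
  rw [H.lie.jacobi i j a ha b hb]
  rcases hij with rfl | rfl <;> simp [koszul_zero_left, koszul_zero_right]

theorem jacobi_odd (H : OddData A br B D b₀) {a b : L}
    (ha : a ∈ A 1) (hb : b ∈ A 1) (c : L) :
    br a (br b c) = br (br a b) c - br b (br a c) := by
  rw [H.lie.jacobi 1 1 a ha b hb, koszul_one_one, neg_one_smul, sub_eq_add_neg]

/-- The bracket of the double extension on homogeneous elements. -/
theorem bracket_zero (H : OddData A br B D b₀) (l s t : K) {a : L} (ha : a ∈ A 0)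
    (g : K × L × K) : oddBracket H.lie.internal br B D b₀ l (s, a, t) g =
      (B (D a) g.2.1 + 2 * t * B g.2.1 b₀ + t * g.2.2 * l,
        br a g.2.1 + t • D g.2.1 - g.2.2 • D a + (t * g.2.2) • (2 : K) • b₀, 0) := by
  rw [oddBracket_apply H.lie.internal H.nis H.mem]
  simp [parityOp_of_mem_zero _ _ ha, H.nis.eq_zero rfl ha H.mem]

theorem bracket_one (H : OddData A br B D b₀) (l s t : K) {a : L} (ha : a ∈ A 1)
    (g : K × L × K) : oddBracket H.lie.internal br B D b₀ l (s, a, t) g =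
      (B (D a) g.2.1 + 2 * t * B g.2.1 b₀ + 2 * g.2.2 * B a b₀ + t * g.2.2 * l,
        br a g.2.1 + t • D g.2.1 + g.2.2 • D a + (t * g.2.2) • (2 : K) • b₀, 0) := by
  rw [oddBracket_apply H.lie.internal H.nis H.mem]
  simp [parityOp_one_of_mem_one _ ha]

theorem mem_grading_zero {g : K × L × K} (h : g ∈ grading A 1 0) :
    ∃ s, ∃ a ∈ A 0, g = (s, a, 0) := by
  obtain ⟨-, h2, h3⟩ := mem_grading.1 h
  exact ⟨g.1, g.2.1, h2, Prod.ext rfl (Prod.ext rfl (h3 (by decide)))⟩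

theorem mem_grading_one {g : K × L × K} (h : g ∈ grading A 1 1) :
    ∃ a ∈ A 1, ∃ t, g = (0, a, t) := by
  obtain ⟨h1, h2, -⟩ := mem_grading.1 h
  exact ⟨g.2.1, h2, g.2.2, Prod.ext (h1 (by decide)) rfl⟩

theorem mk_mem_grading_zero (s : K) {a : L} (h : a ∈ A 0) : (s, a, 0) ∈ grading A 1 0 :=
  mem_grading.2 ⟨fun h => absurd (by decide) h, h, fun _ => rfl⟩

theorem mk_mem_grading_one {a : L} (h : a ∈ A 1) (t : K) : (0, a, t) ∈ grading A 1 1 :=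
  mem_grading.2 ⟨fun _ => rfl, h, fun h => absurd rfl h⟩

theorem skew (H : OddData A br B D b₀) (l : K) (i j : ZMod 2) (g : K × L × K)
    (hg : g ∈ grading A 1 i) (g' : K × L × K) (hg' : g' ∈ grading A 1 j) :
    oddBracket H.lie.internal br B D b₀ l g g' =
      -(koszul K i j • oddBracket H.lie.internal br B D b₀ l g' g) := by
  have hcomm := H.nis.comm H.lie.internal
  rcases zmod_two_eq_zero_or_one i with rfl | rfl <;>
  rcases zmod_two_eq_zero_or_one j with rfl | rfl
  · obtain ⟨s, a, ha, rfl⟩ := mem_grading_zero hg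
    obtain ⟨s', a', ha', rfl⟩ := mem_grading_zero hg'
    rw [H.bracket_zero _ _ _ ha, H.bracket_zero _ _ _ ha', koszul_zero_left]
    refine Prod.ext ?_ (Prod.ext ?_ (by simp)) <;> simp
    · linear_combination H.dinv_zero ha a' - hcomm a (D a')
    · exact H.br_swap_zero_left ha ha'
  · obtain ⟨s, a, ha, rfl⟩ := mem_grading_zero hg
    obtain ⟨a', ha', t', rfl⟩ := mem_grading_one hg'
    rw [H.bracket_zero _ _ _ ha, H.bracket_one _ _ _ ha', koszul_zero_left]
    refine Prod.ext ?_ (Prod.ext ?_ (by simp)) <;> simp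
    · linear_combination H.dinv_zero ha a' - hcomm a (D a') +
        2 * t' * H.nis.eq_zero rfl ha H.mem
    · rw [H.br_swap_zero_left ha ha']; abel
  · obtain ⟨a, ha, t, rfl⟩ := mem_grading_one hg
    obtain ⟨s', a', ha', rfl⟩ := mem_grading_zero hg'
    rw [H.bracket_one _ _ _ ha, H.bracket_zero _ _ _ ha', koszul_zero_right]
    refine Prod.ext ?_ (Prod.ext ?_ (by simp)) <;> simp
    · linear_combination H.nis.eq_zero rfl (H.D_mem_zero ha) ha' +
        H.nis.eq_zero rfl (H.D_mem_one ha') ha + 2 * t * H.nis.eq_zero rfl ha' H.mem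
    · rw [H.br_swap_zero_right ha ha']; abel
  · obtain ⟨a, ha, t, rfl⟩ := mem_grading_one hg
    obtain ⟨a', ha', t', rfl⟩ := mem_grading_one hg'
    rw [H.bracket_one _ _ _ ha, H.bracket_one _ _ _ ha', koszul_one_one]
    refine Prod.ext ?_ (Prod.ext ?_ (by simp)) <;> simp
    · linear_combination H.dinv_one ha a' + hcomm a (D a')
    · rw [H.br_swap_one_one ha ha', mul_comm]; abel

theorem bracket_mem (H : OddData A br B D b₀) (l : K) (i j : ZMod 2) (g : K × L × K)
    (hg : g ∈ grading A 1 i) (g' : K × L × K) (hg' : g' ∈ grading A 1 j) :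
    oddBracket H.lie.internal br B D b₀ l g g' ∈ grading A 1 (i + j) := by
  rcases zmod_two_eq_zero_or_one i with rfl | rfl <;>
  rcases zmod_two_eq_zero_or_one j with rfl | rfl
  · obtain ⟨s, a, ha, rfl⟩ := mem_grading_zero hg
    obtain ⟨s', a', ha', rfl⟩ := mem_grading_zero hg'
    rw [H.bracket_zero _ _ _ ha]
    exact mk_mem_grading_zero _ (by simpa using H.lie.even_br_mem ha ha')
  · obtain ⟨s, a, ha, rfl⟩ := mem_grading_zero hg
    obtain ⟨a', ha', t', rfl⟩ := mem_grading_one hg'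
    have h1 := H.lie.graded 0 1 a ha a' ha'
    have h2 := mk_mem_grading_one (K := K)
      (sub_mem h1 (Submodule.smul_mem _ t' (H.D_mem_one ha))) 0
    simpa [H.bracket_zero _ _ _ ha, H.nis.eq_zero rfl (H.D_mem_one ha) ha'] using h2
  · obtain ⟨a, ha, t, rfl⟩ := mem_grading_one hg
    obtain ⟨s', a', ha', rfl⟩ := mem_grading_zero hg'
    have h1 := H.lie.graded 1 0 a ha a' ha'
    have h2 := mk_mem_grading_one (K := K)
      (add_mem h1 (Submodule.smul_mem _ t (H.D_mem_one ha'))) 0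
    simpa [H.bracket_one _ _ _ ha, H.nis.eq_zero rfl (H.D_mem_zero ha) ha',
      H.nis.eq_zero rfl ha' H.mem] using h2
  · obtain ⟨a, ha, t, rfl⟩ := mem_grading_one hg
    obtain ⟨a', ha', t', rfl⟩ := mem_grading_one hg'
    rw [H.bracket_one _ _ _ ha]
    exact mk_mem_grading_zero _ (add_mem (add_mem (add_mem (H.lie.graded 1 1 a ha a' ha')
      (Submodule.smul_mem _ _ (H.D_mem_zero ha'))) (Submodule.smul_mem _ _ (H.D_mem_zero ha)))
      (Submodule.smul_mem _ _ (Submodule.smul_mem _ _ H.mem)))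

/-- For g = a + t x* the coefficients of the powers of t vanish in turn: [a, [a, a]] = 0, Leibniz
for D [a, a], D² = ad b₀, and D b₀ = 0. The x-component is 0 because x is even and the triple
bracket is odd. -/
theorem cube (H : OddData A br B D b₀) (l : K) (g : K × L × K)
    (hg : g ∈ grading A 1 1) : oddBracket H.lie.internal br B D b₀ l g
      (oddBracket H.lie.internal br B D b₀ l g g) = 0 := by
  obtain ⟨a, ha, t, rfl⟩ := mem_grading_one hg
  have haa := H.lie.graded 1 1 a ha a ha
  have hDa := H.D_mem_zero ha
  rw [H.bracket_one _ _ _ ha (0, a, t), H.bracket_one _ _ _ ha]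
  refine Prod.ext ?_ (Prod.ext ?_ rfl)
  · simp [H.nis.eq_zero rfl hDa hDa, H.nis.eq_zero rfl hDa haa, H.nis.eq_zero rfl haa H.mem,
      H.nis.eq_zero rfl hDa H.mem, H.nis.eq_zero rfl H.mem H.mem]
  · simp [H.lie.odd_cube a ha, H.leibniz_one ha, H.sq, H.br_base, H.map,
      H.br_swap_zero_left hDa ha]
    module

end OddData

end DoubleExt

/-! ### Jacobi identity for an odd derivation -/

namespace DoubleExt.OddData

variable {K L : Type*} [Field K] [AddCommGroup L] [Module K L] {A : ZMod 2 → Submodule K L}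
  {br : L →ₗ[K] L →ₗ[K] L} {B : L →ₗ[K] L →ₗ[K] K} {D : L →ₗ[K] L} {b₀ : L}

/-- Invariance and symmetry move b₀ around: B(a, [c, b₀]) = B([a, c], b₀) = B([b₀, a], c), and ad b₀
= D². -/
theorem form_br_base_eq (H : OddData A br B D b₀) (a c : L) :
    B a (br c b₀) = B (D (D a)) c := by
  rw [← H.nis.invariant, H.nis.comm H.lie.internal, ← H.nis.invariant, H.sq]

theorem jacobi_zero_zero (H : OddData A br B D b₀) (l : K) {a b : L} (ha : a ∈ A 0) (hb : b ∈ A 0)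
    (s s' : K) (g : K × L × K) :
    let brg := oddBracket H.lie.internal br B D b₀ l
    brg (s, a, 0) (brg (s', b, 0) g) = brg (brg (s, a, 0) (s', b, 0)) g +
      brg (s', b, 0) (brg (s, a, 0) g) := by
  intro brg
  obtain ⟨s'', c, t''⟩ := g
  have hab := H.lie.even_br_mem ha hb
  simp only [brg, H.bracket_zero _ _ _ ha, H.bracket_zero _ _ _ hb]
  simp only [zero_mul, mul_zero, zero_smul, add_zero, sub_zero]
  rw [H.bracket_zero _ _ _ hab]
  refine Prod.ext ?_ (Prod.ext ?_ (by simp))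
  · simp [H.leibniz_zero ha, H.nis.invariant, H.br_swap_zero_left ha (H.D_mem_one hb)]
    linear_combination -t'' * H.nis.comm H.lie.internal (D a) (D b)
  · simp [H.leibniz_zero ha, H.jacobi_even (Or.inl rfl) ha hb, H.br_swap_zero_left hb (H.D_mem_one ha)]
    module

theorem jacobi_zero_one (H : OddData A br B D b₀) (l : K) {a b : L} (ha : a ∈ A 0) (hb : b ∈ A 1)
    (s t' : K) (g : K × L × K) :
    let brg := oddBracket H.lie.internal br B D b₀ l
    brg (s, a, 0) (brg (0, b, t') g) = brg (brg (s, a, 0) (0, b, t')) g +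
      brg (0, b, t') (brg (s, a, 0) g) := by
  intro brg
  obtain ⟨s'', c, t''⟩ := g
  have hab : br a b ∈ A 1 := by simpa using H.lie.graded 0 1 a ha b hb
  have hm : br a b - t' • D a ∈ A 1 := sub_mem hab (Submodule.smul_mem _ _ (H.D_mem_one ha))
  simp only [brg, H.bracket_zero _ _ _ ha, H.bracket_one _ _ _ hb]
  simp only [zero_mul, mul_zero, zero_smul, add_zero, sub_zero]
  rw [H.bracket_one _ _ _ hm]
  refine Prod.ext ?_ (Prod.ext ?_ (by simp))
  · simp [H.leibniz_zero ha, H.nis.invariant, H.br_swap_zero_left ha (H.D_mem_zero hb),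
      H.form_D_base]
    linear_combination t' * (H.form_br_base_eq a c).symm * 2 - t' * H.dinv_one (H.D_mem_one ha) c -
      2 * t'' * (H.form_br_base_eq a b) + 2 * t'' * H.dinv_one (H.D_mem_one ha) b * (-1) +
      t'' * H.nis.comm H.lie.internal (D b) (D a)
  · simp [H.leibniz_zero ha, H.jacobi_even (Or.inl rfl) ha hb, H.br_swap_one_one hb (H.D_mem_one ha),
      H.br_base, H.sq]
    module

theorem jacobi_one_one (H : OddData A br B D b₀) (l : K) {a b : L} (ha : a ∈ A 1) (hb : b ∈ A 1)
    (t t' : K) (g : K × L × K) :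
    let brg := oddBracket H.lie.internal br B D b₀ l
    brg (0, a, t) (brg (0, b, t') g) = brg (brg (0, a, t) (0, b, t')) g -
      brg (0, b, t') (brg (0, a, t) g) := by
  intro brg
  obtain ⟨s'', c, t''⟩ := g
  have hab : br a b ∈ A 0 := H.lie.graded 1 1 a ha b hb
  have hm : br a b + t • D b + t' • D a + (t * t') • (2 : K) • b₀ ∈ A 0 :=
    add_mem (add_mem (add_mem hab
      (Submodule.smul_mem _ _ (H.D_mem_zero hb))) (Submodule.smul_mem _ _ (H.D_mem_zero ha)))
      (Submodule.smul_mem _ _ (Submodule.smul_mem _ _ H.mem))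
  simp only [brg, H.bracket_one _ _ _ ha, H.bracket_one _ _ _ hb]
  rw [H.bracket_zero _ _ _ hm]
  refine Prod.ext ?_ (Prod.ext ?_ (by simp))
  · simp [H.leibniz_one ha, H.nis.invariant, H.br_swap_zero_right ha (H.D_mem_zero hb),
      H.form_D_base, H.map, H.form_br_base_eq, H.nis.eq_zero rfl H.mem H.mem,
      H.nis.eq_zero rfl (H.D_mem_zero ha) (H.D_mem_zero hb),
      H.nis.eq_zero rfl (H.D_mem_zero hb) (H.D_mem_zero ha)]
    linear_combination t' * H.dinv_zero (H.D_mem_zero ha) c + t * H.dinv_zero (H.D_mem_zero hb) c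
  · simp [H.leibniz_one ha, H.leibniz_one hb, H.jacobi_odd ha hb, H.br_swap_zero_right hb (H.D_mem_zero ha),
      H.br_base, H.sq, H.map]
    module

/-- The double extension by an odd derivation is a Lie superalgebra. -/
theorem isLieSuperalgebra (H : OddData A br B D b₀) (l : K) :
    IsLieSuperalgebra (grading A 1) (oddBracket H.lie.internal br B D b₀ l) := by
  refine ⟨isInternal_grading H.lie.internal 1, H.bracket_mem l, H.skew l, ?_, H.cube l⟩
  intro i j g hg g' hg' c
  rcases zmod_two_eq_zero_or_one i with rfl | rfl <;>
  rcases zmod_two_eq_zero_or_one j with rfl | rfl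
  · obtain ⟨s, a, ha, rfl⟩ := mem_grading_zero hg
    obtain ⟨s', b, hb, rfl⟩ := mem_grading_zero hg'
    rw [koszul_zero_left, one_smul]
    exact H.jacobi_zero_zero l ha hb s s' c
  · obtain ⟨s, a, ha, rfl⟩ := mem_grading_zero hg
    obtain ⟨b, hb, t, rfl⟩ := mem_grading_one hg'
    rw [koszul_zero_left, one_smul]
    exact H.jacobi_zero_one l ha hb s t c
  · obtain ⟨a, ha, t, rfl⟩ := mem_grading_one hg
    obtain ⟨s, b, hb, rfl⟩ := mem_grading_zero hg'
    -- The odd-even case is the even-odd identity with the two elements exchanged.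
    rw [koszul_zero_right, one_smul, H.skew l 1 0 _ hg _ hg', koszul_zero_right, one_smul, map_neg,
      LinearMap.neg_apply, neg_add_eq_sub]
    exact eq_sub_of_add_eq' (H.jacobi_zero_one l hb ha s t c).symm
  · obtain ⟨a, ha, t, rfl⟩ := mem_grading_one hg
    obtain ⟨b, hb, t', rfl⟩ := mem_grading_one hg'
    rw [koszul_one_one, neg_one_smul, ← sub_eq_add_neg]
    exact H.jacobi_one_one l ha hb t t' c

end DoubleExt.OddData

/-! ### Iterated brackets and Jacobson's sum in the double extension -/

namespace DoubleExt

variable {K L : Type*} [Field K] [AddCommGroup L] [Module K L] {A : ZMod 2 → Submodule K L}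
  {br : L →ₗ[K] L →ₗ[K] L} {B : L →ₗ[K] L →ₗ[K] K} {D : L →ₗ[K] L}

theorem form_iterate_br (hL : IsLieSuperalgebra A br) (hinv : ∀ a b c, B (br a b) c = B a (br b c))
    {a : L} (ha : a ∈ A 0) (n : ℕ) (u y : L) :
    B ((br a)^[n] u) y = (-1) ^ n * B u ((br a)^[n] y) := by
  have h : ∀ u y, B (br a u) y = -B u (br a y) := by
    intro u y
    have hsw : br a u = -br u a := by
      obtain ⟨c, h₀, c', h₁, rfl⟩ := exists_eq_add_of_isInternal hL.internal u
      have h2 := hL.skew 0 0 a ha c h₀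
      have h3 := hL.skew 0 1 a ha c' h₁
      rw [koszul_zero_left, one_smul] at h2 h3
      rw [map_add, map_add, LinearMap.add_apply, h2, h3]
      abel
    rw [hsw, map_neg, LinearMap.neg_apply, hinv]
  induction n generalizing y with
  | zero => simp
  | succ n ih =>
    rw [Function.iterate_succ_apply', h, ih, ← Function.iterate_succ_apply, pow_succ]
    ring

theorem iterate_br_mem (hL : IsLieSuperalgebra A br) {a : L} (ha : a ∈ A 0) {d : ZMod 2} {u : L}
    (hu : u ∈ A d) (n : ℕ) : (br a)^[n] u ∈ A d := by
  induction n with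
  | zero => exact hu
  | succ n ih =>
    rw [Function.iterate_succ_apply']
    simpa using hL.graded 0 d a ha _ ih

/-- The x*-component of y contributes only at the first step, and afterwards it is carried along by
D a. The exponent starts at 2 because the term B(D a, D a) first appears there. -/
theorem iterate_bracket {brg : (K × L × K) →ₗ[K] (K × L × K) →ₗ[K] (K × L × K)} {a : L}
    {u : K × L × K}
    (hbr : ∀ y, brg u y = (B (D a) y.2.1, br a y.2.1 - y.2.2 • D a, 0)) (n : ℕ) (y : K × L × K) :
    (brg u)^[n + 2] y = (B (D a) ((br a)^[n + 1] y.2.1) - y.2.2 * B (D a) ((br a)^[n] (D a)),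
      (br a)^[n + 2] y.2.1 - y.2.2 • (br a)^[n + 1] (D a), 0) := by
  induction n with
  | zero => simp [hbr]
  | succ n ih =>
    rw [Function.iterate_succ_apply', ih, hbr, Function.iterate_succ_apply' (br a) (n + 2),
      Function.iterate_succ_apply' (br a) (n + 1) (D a)]
    simp

/-- The value of `p`-th powers of inner derivations on the double extension. -/
theorem iterate_bracket_prime {p : ℕ} [Fact p.Prime] (hp : 2 < p) {pm : A 0 → A 0}
    (hL : IsRestrictedLieSuperalgebra p A br pm) (hB : IsNIS A br B 1) {d : ZMod 2}
    (hD : IsRestrictedDerivation p A br pm d D)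
    {brg : (K × L × K) →ₗ[K] (K × L × K) →ₗ[K] (K × L × K)} (a : A 0) {u : K × L × K}
    (hbr : ∀ y, brg u y = (B (D a) y.2.1, br a y.2.1 - y.2.2 • D a, 0)) (y : K × L × K) :
    (brg u)^[p] y = (B (D (pm a)) y.2.1, br (pm a) y.2.1 - y.2.2 • D (pm a), 0) := by
  obtain ⟨n, rfl⟩ : ∃ n, p = n + 2 := ⟨p - 2, by omega⟩
  have hDa : D a ∈ A d := by simpa using hD.graded 0 a a.2
  have heven : Even (n + 1) := by
    obtain ⟨k, hk⟩ := (Fact.out : (n + 2).Prime).eq_two_or_odd'.resolve_left (by omega)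
    exact ⟨k, by omega⟩
  have hr := hD.restricted a
  rw [show n + 2 - 1 = n + 1 by omega] at hr
  -- The elements D a and (ad_a)^(p-2)(D a) have equal parity, so the odd form kills their pairing.
  -- As p - 1 is even, (ad_a)^(p-1) moves to the left slot of B without sign and meets D a, giving D
  -- (a^{[p]}) by restrictedness.
  rw [iterate_bracket hbr, hB.eq_zero rfl hDa (iterate_br_mem hL.toIsLieSuperalgebra a.2 hDa n),
    hL.ad_pow, hr, form_iterate_br hL.toIsLieSuperalgebra hB.invariant a.2, heven.neg_one_pow,
    one_mul, mul_zero, sub_zero]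

theorem adCoeff_bracket {brg : (K × L × K) →ₗ[K] (K × L × K) →ₗ[K] (K × L × K)} {a b : L} {s s' : K}
    (ha : ∀ y, brg (s, a, 0) y = (B (D a) y.2.1, br a y.2.1 - y.2.2 • D a, 0))
    (hb : ∀ y, brg (s', b, 0) y = (B (D b) y.2.1, br b y.2.1 - y.2.2 • D b, 0)) (n k : ℕ) :
    (adCoeff brg (s, a, 0) (s', b, 0) n k).2 = (adCoeff br a b n k, 0) := by
  induction n generalizing k with
  | zero => cases k <;> rfl
  | succ n ih => cases k <;> simp [adCoeff, ha, hb, ih]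

/-- Since x is central, the x-component comes from the outermost bracket alone, which applies B(D ·,
·) to an iterate one shorter. This is why σ is built from the power p - 2 and Jacobson's terms from
p - 1. -/
theorem adCoeff_succ_bracket {brg : (K × L × K) →ₗ[K] (K × L × K) →ₗ[K] (K × L × K)} {a b : L}
    {s s' : K} (ha : ∀ y, brg (s, a, 0) y = (B (D a) y.2.1, br a y.2.1 - y.2.2 • D a, 0))
    (hb : ∀ y, brg (s', b, 0) y = (B (D b) y.2.1, br b y.2.1 - y.2.2 • D b, 0)) (n k : ℕ) :
    adCoeff brg (s, a, 0) (s', b, 0) (n + 1) k =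
      (sigmaCoeff br B D a b n k, adCoeff br a b (n + 1) k, 0) := by
  refine Prod.ext ?_ (adCoeff_bracket ha hb _ _)
  cases k <;> simp [adCoeff, ha, hb, adCoeff_bracket ha hb, sigmaCoeff]

theorem jacobsonSum_bracket {p : ℕ} (hp : 2 < p)
    {brg : (K × L × K) →ₗ[K] (K × L × K) →ₗ[K] (K × L × K)} {a b : L}
    {s s' : K} (ha : ∀ y, brg (s, a, 0) y = (B (D a) y.2.1, br a y.2.1 - y.2.2 • D a, 0))
    (hb : ∀ y, brg (s', b, 0) y = (B (D b) y.2.1, br b y.2.1 - y.2.2 • D b, 0)) :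
    jacobsonSum p brg (s, a, 0) (s', b, 0) =
      (∑ i ∈ Finset.Icc 1 (p - 1), sigmaTerm p br B D i a b, jacobsonSum p br a b, 0) := by
  obtain ⟨n, rfl⟩ : ∃ n, p = n + 2 := ⟨p - 2, by omega⟩
  simp only [jacobsonSum, jacobsonTerm, sigmaTerm, show n + 2 - 1 = n + 1 by omega,
    Nat.add_sub_cancel, adCoeff_succ_bracket ha hb]
  refine Prod.ext ?_ (Prod.ext ?_ ?_) <;> simp [Prod.fst_sum, Prod.snd_sum]

/-! ### The p-map for an odd derivation -/

section Odd

variable {b₀ : L}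

theorem OddData.bracket_of_mem_zero (H : OddData A br B D b₀) (l s : K) {a : L} (ha : a ∈ A 0)
    (y : K × L × K) : oddBracket H.lie.internal br B D b₀ l (s, a, 0) y =
      (B (D a) y.2.1, br a y.2.1 - y.2.2 • D a, 0) := by
  rw [H.bracket_zero _ _ _ ha]
  simp

theorem OddData.jacobsonSum_eq (H : OddData A br B D b₀) {p : ℕ} (hp : 2 < p) (l s s' : K)
    (a b : A 0) :
    jacobsonSum p (oddBracket H.lie.internal br B D b₀ l) (s, (a : L), 0) (s', (b : L), 0) =
      (∑ i ∈ Finset.Icc 1 (p - 1), sigmaTerm p br B D i (a : L) b,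
        jacobsonSum p br (a : L) b, 0) :=
  jacobsonSum_bracket hp (H.bracket_of_mem_zero l s a.2) (H.bracket_of_mem_zero l s' b.2)

/-- The sum of the σ_i is the x-component of Jacobson's sum in the double extension, so it inherits
the hypotheses of `exists_homogeneous_of_cocycle`. The value of [x*, x*] along x plays no role, and
l = 0 is taken. -/
theorem OddData.exists_isSigmaMap (H : OddData A br B D b₀) (p : ℕ) [Fact p.Prime] [CharP K p]
    (hp : 2 < p) : ∃ P : A 0 → K, IsSigmaMap p A br B D P := by
  have h2 := two_ne_zero_of_char K hp
  have hg := H.isLieSuperalgebra 0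
  let ι : A 0 → grading A 1 0 := fun a => ⟨(0, a, 0), mk_mem_grading_zero 0 a.2⟩
  have hF : ∀ a b : A 0, (jacobsonSum p (oddBracket H.lie.internal br B D b₀ 0)
      (ι a : K × L × K) (ι b)).1 =
        ∑ i ∈ Finset.Icc 1 (p - 1), sigmaTerm p br B D i (a : L) b := fun a b => by
    rw [H.jacobsonSum_eq hp]
  have hadd : ∀ a b : A 0, (ι a : K × L × K) + ι b = ι (a + b) := fun a b => by simp [ι]
  have hsmul : ∀ (c : K) (a : A 0), (ι (c • a) : K × L × K) = c • (ι a : K × L × K) :=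
    fun c a => by simp [ι]
  obtain ⟨P, h1, h3⟩ := exists_homogeneous_of_cocycle p
    (fun a b => (jacobsonSum p (oddBracket H.lie.internal br B D b₀ 0)
      (ι a : K × L × K) (ι b)).1)
    (fun a b => by rw [hg.jacobsonSum_comm h2])
    (fun a b c => by
      have h := congrArg Prod.fst (hg.jacobsonSum_cocycle h2 p (ι a) (ι b) (ι c))
      rwa [hadd, hadd] at h)
    (fun c a b => by rw [hsmul, hsmul, jacobsonSum_smul_smul (by omega)]; rfl)
    (fun c d a => by
      rw [hsmul, hsmul, hg.jacobsonSum_smul_self h2 (by omega) c d (ι a).2]; rfl)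
  exact ⟨P, h1, fun a b => by rw [h3, ← hF]; ring⟩

theorem OddData.exists_pStructure (H : OddData A br B D b₀) (l : K) (p : ℕ) [Fact p.Prime]
    [CharP K p] (hp : 2 < p) {pm : A 0 → A 0} (hL : IsRestrictedLieSuperalgebra p A br pm)
    (hD : IsRestrictedDerivation p A br pm 1 D) {P : A 0 → K} (hP : IsSigmaMap p A br B D P)
    (m : K) {c₀ : L} (hc : c₀ ∈ A 0) (hcent : ∀ a : L, br c₀ a = 0) (hDc : D c₀ = 0) :
    ∃ pg : grading A 1 0 → grading A 1 0,
      IsRestrictedLieSuperalgebra p (grading A 1) (oddBracket H.lie.internal br B D b₀ l) pg ∧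
      (∀ a : A 0, (pg ⟨ofL (a : L), ofL_mem A 1 0 a⟩ : K × L × K) = ofL (pm a : L) + P a • x) ∧
      (pg ⟨x, x_mem A⟩ : K × L × K) = m • x + ofL c₀ := by
  have hp0 : p ≠ 0 := by omega
  let pr : grading A 1 0 → A 0 := fun g => ⟨g.1.2.1, (mem_grading.1 g.2).2.1⟩
  -- On Kx ⊕ 𝔞₀ with x central there is no mixed Jacobson term, so the p-map is the sum of its
  -- prescribed values on the summands. The summand c₀ does not affect ad, being central and killed
  -- by D.
  let pg : grading A 1 0 → grading A 1 0 := fun g =>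
    ⟨(g.1.1 ^ p * m + P (pr g), g.1.1 ^ p • c₀ + pm (pr g), 0), mk_mem_grading_zero _
      (add_mem (Submodule.smul_mem _ _ hc) (pm _).2)⟩
  have hg : ∀ g : grading A 1 0, (g : K × L × K) = (g.1.1, (pr g : L), 0) := fun g =>
    Prod.ext rfl (Prod.ext rfl ((mem_grading.1 g.2).2.2 (by decide)))
  have hpm0 : pm 0 = 0 := by simpa [hp0] using hL.smul_pow 0 0
  have hP0 : P 0 = 0 := by simpa [hp0] using hP.smul 0 0
  refine ⟨pg, ⟨H.isLieSuperalgebra l, ?_, ?_, ?_⟩, ?_, ?_⟩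
  · intro g y
    rw [hg g, iterate_bracket_prime hp hL H.nis hD (pr g)
      (H.bracket_of_mem_zero l g.1.1 (pr g).2), H.bracket_of_mem_zero l _
      (add_mem (Submodule.smul_mem _ _ hc) (pm _).2)]
    simp [hcent, hDc]
  · intro c g
    have h : pr (c • g) = c • pr g := rfl
    refine Subtype.ext (Prod.ext ?_ (Prod.ext ?_ ?_))
    · simp [pg, h, hP.smul]; ring
    · simp [pg, h, hL.smul_pow, mul_pow, smul_smul]
    · simp [pg]
  · intro g g'
    have h : pr (g + g') = pr g + pr g' := rfl
    have hj := H.jacobsonSum_eq hp l g.1.1 g'.1.1 (pr g) (pr g')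
    rw [← hg, ← hg] at hj
    change _ = _ + jacobsonSum _ _ _ _
    rw [hj]
    have h1 := hP.add (pr g) (pr g')
    have h2 := hL.add_pow (pr g) (pr g')
    refine Prod.ext ?_ (Prod.ext ?_ ?_)
    · simp only [pg, h, Prod.fst_add, Submodule.coe_add, add_pow_char]
      linear_combination h1
    · simp only [pg, h, Prod.snd_add, Prod.fst_add, Submodule.coe_add, add_pow_char, h2, jacobsonSum]
      module
    · simp [pg]
  · intro a
    have h : pr ⟨ofL (a : L), ofL_mem A 1 0 a⟩ = a := rfl
    simp only [pg, h]
    simp [ofL, x, hp0]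
  · have h : pr ⟨x, x_mem A⟩ = 0 := rfl
    simp only [pg, h]
    simp [ofL, x, hP0, hpm0]

end Odd

end DoubleExt

/-! ### The p-map for an even derivation -/

namespace DoubleExt

section Even

variable {K L : Type*} [Field K] [AddCommGroup L] [Module K L] {A : ZMod 2 → Submodule K L}
  {br : L →ₗ[K] L →ₗ[K] L} {B : L →ₗ[K] L →ₗ[K] K} {D : L →ₗ[K] L}

theorem mk_mem_grading_even {a : L} (h : a ∈ A 0) (t : K) : (0, a, t) ∈ grading A 0 0 :=
  mem_grading.2 ⟨fun _ => rfl, h, fun h => absurd rfl h⟩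

/-- An even derivation that leaves an odd form invariant satisfies `B (D a) [a, a] = 0` for odd
`a` in characteristic different from 3. -/
theorem form_D_br_self_eq_zero {p : ℕ} [Fact p.Prime] [CharP K p] (hp3 : p ≠ 3)
    (hA : IsLieSuperalgebra A br) (hB : IsNIS A br B 1) (hD : IsDInvariant A B 0 D)
    (hgr : ∀ i : ZMod 2, ∀ a ∈ A i, D a ∈ A i)
    (hleib : ∀ a b : L, D (br a b) = br (D a) b + br a (D b)) {a : L} (ha : a ∈ A 1) :
    B (D a) (br a a) = 0 := by
  have h1 : br a (D a) = br (D a) a := by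
    rw [hA.skew 1 1 a ha (D a) (hgr 1 a ha), koszul_one_one, neg_one_smul, neg_neg]
  have h2 := hD.even_apply hA.internal (br a a) a
  have h3 := hB.comm hA.internal (br a a) (D a)
  rw [hleib, h1, map_add, LinearMap.add_apply, hB.invariant] at h2
  have h4 : (3 : K) ≠ 0 := by
    have : ((3 : ℕ) : K) ≠ 0 := by
      rw [Ne, CharP.cast_eq_zero_iff K p]
      exact fun h => hp3 ((Nat.prime_dvd_prime_iff_eq Fact.out Nat.prime_three).1 h)
    exact_mod_cast this
  -- By Leibniz and invariance B(D [a, a], a) = 2 B(D a, [a, a]), while D-invariance makes it -B(D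
  -- a, [a, a]); hence 3 B(D a, [a, a]) = 0.
  refine (mul_eq_zero.1 ?_).resolve_left h4
  linear_combination h2 - h3

theorem evenBracket_of_mem (hA : DirectSum.IsInternal A) (a : L) (y : K × L × K) :
    evenBracket hA br B D (0, a, 0) y = (B (D a) y.2.1, br a y.2.1 - y.2.2 • D a, 0) := by
  rw [evenBracket_apply]
  simp

theorem evenBracket_xs (hA : DirectSum.IsInternal A) (y : K × L × K) :
    evenBracket hA br B D xs y = (0, D y.2.1, 0) := by
  simp [evenBracket_apply, xs]

theorem iterate_evenBracket_xs (hA : DirectSum.IsInternal A) (y : K × L × K) (n : ℕ) :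
    (evenBracket hA br B D xs)^[n + 1] y = (0, D^[n + 1] y.2.1, 0) := by
  induction n with
  | zero => exact evenBracket_xs hA y
  | succ n ih => rw [Function.iterate_succ_apply', ih, evenBracket_xs,
      Function.iterate_succ_apply' D (n + 1)]

theorem iterate_smul_br {M : Type*} [AddCommGroup M] [Module K M] (brg : M →ₗ[K] M →ₗ[K] M) (c : K)
    (u y : M) (n : ℕ) : (brg (c • u))^[n] y = c ^ n • (brg u)^[n] y := by
  rw [← Module.End.pow_apply, ← Module.End.pow_apply, map_smul, smul_pow, LinearMap.smul_apply]

theorem exists_pStructure_even (p : ℕ) [Fact p.Prime] [CharP K p] (hp : 2 < p) {pm : A 0 → A 0}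
    (hL : IsRestrictedLieSuperalgebra p A br pm) (hB : IsNIS A br B 1)
    (hD : IsRestrictedDerivation p A br pm 0 D)
    (hg : IsLieSuperalgebra (grading A 0) (evenBracket hL.internal br B D))
    {γ : K} {a₀ : L} (ha₀ : a₀ ∈ A 0) (hDp : ∀ a : L, D^[p] a = γ • D a + br a₀ a)
    (hDa : D a₀ = 0) :
    ∃ pg : grading A 0 0 → grading A 0 0,
      IsRestrictedLieSuperalgebra p (grading A 0) (evenBracket hL.internal br B D) pg ∧
      (∀ a : A 0, (pg ⟨ofL (a : L), ofL_mem A 0 0 a⟩ : K × L × K) = ofL (pm a : L)) ∧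
      (pg ⟨xs, xs_mem A⟩ : K × L × K) = γ • xs + ofL a₀ := by
  have hp0 : p ≠ 0 := by omega
  have h2 := two_ne_zero_of_char K hp
  set brg := evenBracket hL.internal br B D with hbrg
  let pr : grading A 0 0 → A 0 := fun g => ⟨g.1.2.1, (mem_grading.1 g.2).2.1⟩
  let ι : A 0 → grading A 0 0 := fun a => ⟨(0, a, 0), mk_mem_grading_even a.2 0⟩
  let X : grading A 0 0 := ⟨xs, xs_mem A⟩
  let w : grading A 0 0 := ⟨(0, a₀, γ), mk_mem_grading_even ha₀ γ⟩
  let S : grading A 0 0 → grading A 0 0 → grading A 0 0 := fun g g' =>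
    ⟨jacobsonSum p brg (g : K × L × K) g', hg.jacobsonSum_mem h2 p g g'⟩
  -- The law for sums leaves no choice once the values on 𝔞₀ and x* are fixed: w = γ x* + a₀ is the
  -- p-th power of x*, and S supplies the mixed terms.
  let pg : grading A 0 0 → grading A 0 0 := fun g =>
    ι (pm (pr g)) + g.1.2.2 ^ p • w + S (ι (pr g)) (g.1.2.2 • X)
  have hdec : ∀ g : grading A 0 0, g = ι (pr g) + g.1.2.2 • X := fun g => Subtype.ext
    (Prod.ext (by simpa [ι, X, xs] using (mem_grading.1 g.2).1 (by decide))
      (Prod.ext (by simp [ι, X, xs, pr]) (by simp [ι, X, xs])))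
  have hpm0 : pm 0 = 0 := by simpa [hp0] using hL.smul_pow 0 0
  have hι0 : ι 0 = 0 := rfl
  have hιadd : ∀ a b, ι (a + b) = ι a + ι b := fun a b => Subtype.ext (by simp [ι])
  have hιsmul : ∀ (c : K) a, ι (c • a) = c • ι a := fun c a => Subtype.ext (by simp [ι])
  have hScomm : ∀ g g', S g g' = S g' g := fun g g' => Subtype.ext (hg.jacobsonSum_comm h2 p g g')
  have hScoc : ∀ g g' g'', S g g' + S (g + g') g'' = S g' g'' + S g (g' + g'') :=
    fun g g' g'' => Subtype.ext (hg.jacobsonSum_cocycle h2 p g g' g'')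
  have hSself : ∀ (c d : K) g, S (c • g) (d • g) = 0 := fun c d g =>
    Subtype.ext (hg.jacobsonSum_smul_self h2 (by omega) c d g.2)
  have hSsmul : ∀ (c : K) g g', S (c • g) (c • g') = c ^ p • S g g' := fun c g g' =>
    Subtype.ext (jacobsonSum_smul_smul (by omega) brg c (g : K × L × K) g')
  have hSz : ∀ g, S g 0 = 0 := fun g => by simpa using hSself 1 0 g
  have hSι : ∀ a b : A 0, ι (pm (a + b)) = ι (pm a) + ι (pm b) + S (ι a) (ι b) := by
    intro a b
    have h := jacobsonSum_bracket hp (s := 0) (s' := 0) (B := B) (D := D) (brg := brg)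
      (evenBracket_of_mem hL.internal (a : L)) (evenBracket_of_mem hL.internal (b : L))
    -- Now x is odd, so the x-component of an even element vanishes; no correction 𝒫 is needed.
    have hz : ∑ i ∈ Finset.Icc 1 (p - 1), sigmaTerm p br B D i (a : L) b = 0 := by
      have h3 := (mem_grading.1 (S (ι a) (ι b)).2).1 (by decide)
      change (jacobsonSum p brg (0, (a : L), 0) (0, (b : L), 0)).1 = 0 at h3
      rwa [h] at h3
    refine Subtype.ext ?_
    change ((0 : K), (pm (a + b) : L), (0 : K)) = (0, (pm a : L), 0) + (0, (pm b : L), 0) +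
      jacobsonSum p brg (0, (a : L), 0) (0, (b : L), 0)
    rw [h, hz, hL.add_pow]
    simp [jacobsonSum]
  refine ⟨pg, ⟨hg, ?_, ?_, ?_⟩, ?_, ?_⟩
  · intro g y
    have h := hg.br_jacobsonSum h2 p (ι (pr g)) (g.1.2.2 • X) y
    have h1 : ((ι (pr g) : K × L × K) + (g.1.2.2 • X : grading A 0 0)) = g :=
      congrArg Subtype.val (hdec g).symm
    have h3 : brg (ι (pm (pr g))) y = (brg (ι (pr g) : K × L × K))^[p] y := by
      rw [iterate_bracket_prime hp hL hB hD (pr g) (evenBracket_of_mem hL.internal _)]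
      exact evenBracket_of_mem hL.internal _ _
    -- This is the p-property: (ad x*)^p acts as D^p = γ D + ad a₀, and D a₀ = 0 removes the
    -- remaining terms of ad w.
    have h4 : brg (w : K × L × K) y = (brg xs)^[p] y := by
      rw [← Nat.sub_add_cancel (by omega : 1 ≤ p), iterate_evenBracket_xs,
        Nat.sub_add_cancel (by omega : 1 ≤ p), hDp, hbrg, evenBracket_apply]
      simp [w, hDa, add_comm]
    rw [h1] at h
    have h5 : (brg ((g.1.2.2 • X : grading A 0 0) : K × L × K))^[p] y =
        g.1.2.2 ^ p • (brg xs)^[p] y := iterate_smul_br _ _ _ _ _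
    rw [h5, ← h4, ← h3] at h
    change brg ((ι (pm (pr g)) : K × L × K) + g.1.2.2 ^ p • (w : K × L × K) +
      jacobsonSum p brg (ι (pr g) : K × L × K) ((g.1.2.2 • X : grading A 0 0) : K × L × K)) y = _
    rw [map_add, map_add, map_smul, LinearMap.add_apply, LinearMap.add_apply,
      LinearMap.smul_apply, h]
    abel
  · intro c g
    have h : pr (c • g) = c • pr g := rfl
    have h' : (c • g).1.2.2 = c * g.1.2.2 := rfl
    simp only [pg, h, h', hL.smul_pow, hιsmul, mul_smul, hSsmul, mul_pow, smul_add]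
  · intro g g'
    have h : pr (g + g') = pr g + pr g' := rfl
    have h' : (g + g').1.2.2 = g.1.2.2 + g'.1.2.2 := rfl
    have key : pg (g + g') = pg g + pg g' + S g g' := by
      have e : S g g' = S (ι (pr g) + g.1.2.2 • X) (ι (pr g') + g'.1.2.2 • X) := by
        rw [← hdec, ← hdec]
      rw [e]
      simp only [pg, h, h', hSι, hιadd, add_pow_char, add_smul]
      generalize ι (pr g) = a
      generalize ι (pr g') = b
      have e0 := hSself g.1.2.2 g'.1.2.2 X
      generalize g.1.2.2 • X = s at *
      generalize g'.1.2.2 • X = t at *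
      -- With s and t the multiples of x*, the goal compares S(a, b) + S(a+b, s+t) with S(a, s) +
      -- S(b, t) + S(a+s, b+t). Two cocycle identities bring both to S(a, b+s+t), and the other two,
      -- with S(s, t) = 0, match what is left.
      have e1 := hScoc a b (s + t)
      have e2 := hScoc b s t
      have e3 := hScoc a s (b + t)
      have e4 := hScoc s b t
      rw [e0, zero_add, hScomm b s, add_comm b s, e4] at e2
      rw [show s + (b + t) = b + (s + t) by abel] at e3
      linear_combination (norm := module) e1 - e3 - e2
    exact congrArg Subtype.val key
  · intro a
    have h : pr ⟨ofL (a : L), ofL_mem A 0 0 a⟩ = a := rfl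
    have h' : (ofL (a : L) : K × L × K).2.2 = 0 := rfl
    simp only [pg, h, h', zero_smul, hSz, zero_pow hp0, add_zero]
    rfl
  · have h : pr ⟨xs, xs_mem A⟩ = 0 := rfl
    have h' : (xs : K × L × K).2.2 = 1 := rfl
    simp only [pg, h, h', hpm0, hι0, one_pow, one_smul, hScomm 0, hSz, add_zero, zero_add]
    simp [w, xs, ofL]

end Even

end DoubleExt

theorem mainTheorem4 {K L : Type*} [Field K] [AddCommGroup L] [Module K L]
    (p : ℕ) [Fact p.Prime] [CharP K p] (hp : 2 < p)
    (A : ZMod 2 → Submodule K L) (br : L →ₗ[K] L →ₗ[K] L) (pm : A 0 → A 0)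
    (hL : IsRestrictedLieSuperalgebra p A br pm)
    (B : L →ₗ[K] L →ₗ[K] K) (hB : IsNIS A br B 1) :
    (∀ (D : L →ₗ[K] L) (b₀ : L) (l₀ : K),
      IsRestrictedDerivation p A br pm 1 D → IsDInvariant A B 1 D →
      b₀ ∈ A 0 → (∀ a : L, D (D a) = br b₀ a) → D b₀ = 0 →
      IsNIS (DoubleExt.grading A 1) (DoubleExt.oddBracket hL.internal br B D b₀ l₀)
        (DoubleExt.form B) 1 ∧
      (∃ P : A 0 → K, IsSigmaMap p A br B D P) ∧
      ∀ P : A 0 → K, IsSigmaMap p A br B D P →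
      ∀ (m : K) (c₀ : L), c₀ ∈ A 0 → (∀ a : L, br c₀ a = 0) → D c₀ = 0 →
      ∃ pg : DoubleExt.grading A 1 0 → DoubleExt.grading A 1 0,
        IsRestrictedLieSuperalgebra p (DoubleExt.grading A 1)
          (DoubleExt.oddBracket hL.internal br B D b₀ l₀) pg ∧
        (∀ a : A 0, (pg ⟨DoubleExt.ofL (a : L), DoubleExt.ofL_mem A 1 0 a⟩ : K × L × K) =
          DoubleExt.ofL (pm a : L) + P a • DoubleExt.x) ∧
        (pg ⟨DoubleExt.x, DoubleExt.x_mem A⟩ : K × L × K) =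
          m • DoubleExt.x + DoubleExt.ofL c₀) ∧
    (∀ (D : L →ₗ[K] L) (γ : K) (a₀ : L),
      IsRestrictedDerivation p A br pm 0 D → IsDInvariant A B 0 D →
      a₀ ∈ A 0 → (∀ a : L, D^[p] a = γ • D a + br a₀ a) → D a₀ = 0 →
      (p = 3 → ∀ a ∈ A 1, B (D a) (br a a) = 0) →
      IsNIS (DoubleExt.grading A 0) (DoubleExt.evenBracket hL.internal br B D)
        (DoubleExt.form B) 1 ∧
      ∃ pg : DoubleExt.grading A 0 0 → DoubleExt.grading A 0 0,
        IsRestrictedLieSuperalgebra p (DoubleExt.grading A 0)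
          (DoubleExt.evenBracket hL.internal br B D) pg ∧
        (∀ a : A 0, (pg ⟨DoubleExt.ofL (a : L), DoubleExt.ofL_mem A 0 0 a⟩ : K × L × K) =
          DoubleExt.ofL (pm a : L)) ∧
        (pg ⟨DoubleExt.xs, DoubleExt.xs_mem A⟩ : K × L × K) =
          γ • DoubleExt.xs + DoubleExt.ofL a₀) := by
  have hlie := hL.toIsLieSuperalgebra
  refine ⟨?_, ?_⟩
  · intro D b₀ l₀ hD hinv hb hsq hDb
    have H : DoubleExt.OddData A br B D b₀ :=
      ⟨hlie, hB, hD.graded, hD.leibniz, hinv, hb, hsq, hDb⟩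
    exact ⟨DoubleExt.isNIS_form hL.internal hB 1
      (DoubleExt.oddBracket_invariant hL.internal hB hinv hb l₀), H.exists_isSigmaMap p hp,
      fun P hP m c₀ hc hcent hDc => H.exists_pStructure l₀ p hp hL hD hP m hc hcent hDc⟩
  · intro D γ a₀ hD hinv ha₀ hDp hDa hp3
    have hgr : ∀ i : ZMod 2, ∀ a ∈ A i, D a ∈ A i := fun i a ha => by
      simpa using hD.graded i a ha
    have hleib : ∀ a b : L, D (br a b) = br (D a) b + br a (D b) := fun a b => by
      obtain ⟨c, h₀, c', h₁, rfl⟩ := exists_eq_add_of_isInternal hL.internal a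
      simp only [map_add, LinearMap.add_apply, hD.leibniz 0 c h₀, hD.leibniz 1 c' h₁,
        koszul_zero_left, one_smul]
      abel
    have hcube : ∀ a ∈ A 1, B (D a) (br a a) = 0 := fun a ha => by
      by_cases h : p = 3
      · exact hp3 h a ha
      · exact DoubleExt.form_D_br_self_eq_zero h hlie hB hinv hgr hleib ha
    exact ⟨DoubleExt.isNIS_form hL.internal hB 0
      (DoubleExt.evenBracket_invariant hL.internal hB hinv),
      DoubleExt.exists_pStructure_even p hp hL hB hD
        (DoubleExt.isLieSuperalgebra_even hlie hB hgr hleib hinv hcube) ha₀ hDp hDa⟩
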